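/- Let $\Omega\subset\mathbb{R}^3$ be a bounded open set, let $\omega,\mu_o,\varepsilon_o>0$, and for $j=1,2$ let $\mu_j,\varepsilon_j,\sigma_j:\mathbb{R}^3\to\mathbb{R}$ be Lipschitz functions such that $\mu_j>0$ and $\varepsilon_j>0$ on $\mathbb{R}^3$; $\mu_j\ge\mu_o$, $\varepsilon_j\ge\varepsilon_o$, $\sigma_j\ge 0$ on $\overline\Omega$; $\mu_j=\mu_o$, $\varepsilon_j=\varepsilon_o$, $\sigma_j=0$ outside some ball; and $\mu_1=\mu_2$, $\varepsilon_1=\varepsilon_2$, $\sigma_1=\sigma_2$ on $\mathbb{R}^3\setminus\Omega$. Put $\gamma_j=\varepsilon_j+i\sigma_j/\omega$, take principal square roots, and set $$s=\gamma_1^{1/2}+\gamma_2^{1/2},\qquad t=\mu_1^{1/2}+\mu_2^{1/2},$$ $$a=\mathbf 1_\Omega\,\omega^2\gamma_1^{1/2}\gamma_2^{1/2}(\mu_1+\mu_2),\qquad b=\mathbf 1_\Omega\,\omega^2\gamma_1^{1/2}\gamma_2^{1/2}(\gamma_1+\gamma_2)\,\frac{t}{s},$$ $$c=\mathbf 1_\Omega\,\omega^2\mu_1^{1/2}\mu_2^{1/2}(\gamma_1+\gamma_2),\qquad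 d=\mathbf 1_\Omega\,\omega^2\mu_1^{1/2}\mu_2^{1/2}(\mu_1+\mu_2)\,\frac{s}{t}.$$ Let $V=\Delta s/s$ and $W=\Delta t/t$ be the weak potentials defined by $$\langle Vu,\varphi\rangle=-\int_{\mathbb{R}^3}\nabla s\cdot\nabla\Big(\frac{u\varphi}{s}\Big)\,dx,\qquad \langle Wu,\varphi\rangle=-\int_{\mathbb{R}^3}\nabla t\cdot\nabla\Big(\frac{u\varphi}{t}\Big)\,dx$$ for $u\in H^1(\mathbb{R}^3)$ and $\varphi\in C_c^\infty(\mathbb{R}^3)$, with weak gradients and without complex conjugation. Suppose $f,g\in H^1(\mathbb{R}^3)$ are complex-valued, compactly supported, and satisfy weakly on $\mathbb{R}^3$ $$-\Delta f+Vf+af+bg=0,\qquad -\Delta g+Wg+cg+df=0,$$ that is, for every complex-valued $\varphi\in C_c^\infty(\mathbb{R}^3)$, $$\int\nabla f\cdot\nabla\varphi\,dx+\langle Vf,\varphi\rangle+\int(af+bg)\varphi\,dx=0,\qquad \int\nabla g\cdot\nabla\varphi\,dx+\langle Wg,\varphi\rangle+\int(cg+df)\varphi\,dx=0.$$ Then $f=g=0$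 (almost everywhere). -/

import Mathlib

open MeasureTheory Set

noncomputable section

/-- Three-dimensional Euclidean space. -/
abbrev R3 : Type := EuclideanSpace ℝ (Fin 3)

/-- The classical partial derivative of a complex-valued function on `R3`. -/
def partialDeriv (i : Fin 3) (φ : R3 → ℂ) (x : R3) : ℂ :=
  fderiv ℝ φ x (EuclideanSpace.single i 1)

/-- Complex-valued test functions: smooth with compact support. -/
def IsTestFunction (φ : R3 → ℂ) : Prop :=
  ContDiff ℝ (⊤ : ℕ∞) φ ∧ HasCompactSupport φ

/-- `U` is a weak `i`-th partial derivative of `u`. -/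
def HasWeakDeriv (i : Fin 3) (u U : R3 → ℂ) : Prop :=
  LocallyIntegrable u ∧ LocallyIntegrable U ∧
    ∀ φ : R3 → ℂ, IsTestFunction φ → ∫ x, u x * partialDeriv i φ x = -∫ x, U x * φ x

/-- Weak derivatives are unique almost everywhere. -/
theorem HasWeakDeriv.ae_eq {i : Fin 3} {u U U' : R3 → ℂ}
    (h : HasWeakDeriv i u U) (h' : HasWeakDeriv i u U') : U =ᵐ[volume] U' := by
  apply ae_eq_of_integral_contDiff_smul_eq h.2.1 h'.2.1
  intro φ hφ hc
  have ht : IsTestFunction (fun x => (φ x : ℂ)) :=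
    ⟨Complex.ofRealCLM.contDiff.comp hφ, hc.comp_left Complex.ofReal_zero⟩
  have key := neg_injective ((h.2.2 _ ht).symm.trans (h'.2.2 _ ht))
  simpa only [Complex.real_smul, mul_comm] using key

open Classical in
/-- The weak `i`-th partial derivative of `u`, as a function defined almost everywhere
(zero if `u` has no weak derivative). -/
def weakDeriv (i : Fin 3) (u : R3 → ℂ) : R3 → ℂ :=
  if h : ∃ U, HasWeakDeriv i u U then h.choose else 0

/-- The bilinear pairing `⟨V u, φ⟩ = - ∫ ∇s · ∇(u φ / s)` that defines the weak potential
`V = (Δ s) / s`. -/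
def weakPotential (s u φ : R3 → ℂ) : ℂ :=
  ∫ x, -∑ i, weakDeriv i s x * weakDeriv i (fun y => u y * φ y / s y) x

/-- `u` and `v` satisfy `-Δ u + V u + p u + q v = 0` weakly on the whole space, where
`V = (Δ s) / s` is the weak potential of `s`. -/
def IsWeakSolution (s p q u v : R3 → ℂ) : Prop :=
  ∀ φ : R3 → ℂ, IsTestFunction φ →
    (∫ x, ∑ i, weakDeriv i u x * partialDeriv i φ x) + weakPotential s u φ
      + (∫ x, (p x * u x + q x * v x) * φ x) = 0

/-- The principal square root of a complex-valued function. -/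
def sqrtFun (ρ : R3 → ℂ) (x : R3) : ℂ := ρ x ^ (1 / 2 : ℂ)

/-- `ρ₁ ^ (1/2) + ρ₂ ^ (1/2)`. -/
def sqrtSum (ρ₁ ρ₂ : R3 → ℂ) (x : R3) : ℂ := sqrtFun ρ₁ x + sqrtFun ρ₂ x

/-- `1_Ω ω² ρ₁^(1/2) ρ₂^(1/2) (τ₁ + τ₂)`: the coefficient `a` for `ρ = γ`, `τ = μ`, and `c` for
`ρ = μ`, `τ = γ`. -/
def diagCoeff (Ω : Set R3) (ω : ℝ) (ρ₁ ρ₂ τ₁ τ₂ : R3 → ℂ) : R3 → ℂ :=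
  Ω.indicator fun x => (ω : ℂ) ^ 2 * sqrtFun ρ₁ x * sqrtFun ρ₂ x * (τ₁ x + τ₂ x)

/-- `1_Ω ω² ρ₁^(1/2) ρ₂^(1/2) (ρ₁ + ρ₂) (τ₁^(1/2) + τ₂^(1/2)) / (ρ₁^(1/2) + ρ₂^(1/2))`: the
coefficient `b` for `ρ = γ`, `τ = μ`, and `d` for `ρ = μ`, `τ = γ`. -/
def offDiagCoeff (Ω : Set R3) (ω : ℝ) (ρ₁ ρ₂ τ₁ τ₂ : R3 → ℂ) : R3 → ℂ :=
  Ω.indicator fun x => (ω : ℂ) ^ 2 * sqrtFun ρ₁ x * sqrtFun ρ₂ x * (ρ₁ x + ρ₂ x)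
    * (sqrtSum τ₁ τ₂ x / sqrtSum ρ₁ ρ₂ x)

/-- The complex permittivity `γ = ε + i σ / ω`. -/
def complexPermittivity (ω : ℝ) (ε σ : R3 → ℝ) (x : R3) : ℂ :=
  (ε x : ℂ) + Complex.I * (σ x : ℂ) / (ω : ℂ)

/-- Electromagnetic parameters on `Ω`, extended to Lipschitz functions on the whole space that are
equal to the background constants `μ₀`, `ε₀`, `0` outside a ball. -/
structure IsAdmissible (Ω : Set R3) (μ₀ ε₀ : ℝ) (μ ε σ : R3 → ℝ) : Prop where
  lipschitz_μ : ∃ K, LipschitzWith K μ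
  lipschitz_ε : ∃ K, LipschitzWith K ε
  lipschitz_σ : ∃ K, LipschitzWith K σ
  le_μ : ∀ x ∈ closure Ω, μ₀ ≤ μ x
  le_ε : ∀ x ∈ closure Ω, ε₀ ≤ ε x
  nonneg_σ : ∀ x ∈ closure Ω, 0 ≤ σ x
  pos_μ : ∀ x, 0 < μ x
  pos_ε : ∀ x, 0 < ε x
  eq_background : ∃ R : ℝ, ∀ x, R ≤ ‖x‖ → μ x = μ₀ ∧ ε x = ε₀ ∧ σ x = 0

/-- A class of functions has a representative that vanishes outside a compact set. -/
def IsCompactlySupported (f : Lp ℂ 2 (volume : Measure R3)) : Prop :=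
  ∃ K : Set R3, IsCompact K ∧ ∀ᵐ x, x ∉ K → f x = 0

/-- The class `f ∈ L²(R3)` belongs to the Sobolev space `H¹(R3)`. -/
def MemH1 (f : Lp ℂ 2 (volume : Measure R3)) : Prop :=
  TemperedDistribution.MemSobolev 1 2 (f : TemperedDistribution R3 ℂ)

end

/-! As `s` is only Lipschitz, the potential Δs/s is a distribution, but division by `s` removes it:
with f = sF, formally -Δ(sF) + (Δs/s)sF = -sΔF - 2∇s·∇F, where no second derivative of `s` is left.
The parameters are Lipschitz with real part bounded below by a positive constant, so `s` and 1/s are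
admissible Lipschitz multipliers. Hence ΔF is square integrable and |ΔF| ≤ C(|∇F| + |F| + |g|). The
same holds for G = g/t, and g = tG is controlled by G on the support. This is
`IsWeakSolution.exists_isLaplacianPair`.

What remains is a pair of compactly supported functions obeying coupled differential inequalities on
all of space. A Carleman estimate kills them: with w = exp(τ|x|²/2), τ‖w∇u‖² + 6τ²‖wu‖² ≤ 2‖wΔu‖².
Since there is no boundary, one fixed τ, large compared with the constant in the inequalities,
absorbs the right-hand sides (`IsLaplacianPair.eq_zero_of_coupled_inequality`).

For smooth functions the estimate comes from the commutator method. Conjugating Δ by `w` gives S + A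
with S = Δ + τ²|x|² symmetric and A = -2τ x·∇ - 3τ skew, and [S, A] = 4τ(-Δ + τ²|x|²) is a multiple
of the harmonic oscillator, which is at least 3τ (`integral_symm_mul_skew`,
`integral_sum_realPartialDeriv_sq_ge`). Mollification and Fatou's lemma carry it over to weak
derivatives, at the cost of the factor 2 (`carleman_weak`). -/

/-! ### Mollification of functions, weak derivatives and weak divergences. -/

noncomputable section Mollification

open Filter Topology ContinuousLinearMap
open scoped Convolution

/-- A sequence of bump functions shrinking to the origin. -/
def shrinkingBump (n : ℕ) : ContDiffBump (0 : R3) where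
  rIn := 1 / (2 * (n + 1))
  rOut := 1 / (n + 1)
  rIn_pos := by positivity
  rIn_lt_rOut := by
    apply one_div_lt_one_div_of_lt <;> [positivity; linarith [(n.cast_nonneg : (0 : ℝ) ≤ n)]]

/-- The standard mollifier sequence. -/
def mollifier (n : ℕ) : R3 → ℝ := (shrinkingBump n).normed volume

/-- Mollification of a function by the standard mollifier sequence. -/
def mollify (n : ℕ) (u : R3 → ℂ) : R3 → ℂ := mollifier n ⋆[lsmul ℝ ℝ, volume] u

lemma tendsto_rOut_shrinkingBump : Tendsto (fun n => (shrinkingBump n).rOut) atTop (𝓝 0) :=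
  tendsto_one_div_add_atTop_nhds_zero_nat

lemma mollifier_nonneg (n : ℕ) (x : R3) : 0 ≤ mollifier n x := (shrinkingBump n).nonneg_normed x

lemma contDiff_mollifier (n : ℕ) {k : ℕ∞} : ContDiff ℝ k (mollifier n) :=
  (shrinkingBump n).contDiff_normed

lemma hasCompactSupport_mollifier (n : ℕ) : HasCompactSupport (mollifier n) :=
  (shrinkingBump n).hasCompactSupport_normed

lemma integral_mollifier (n : ℕ) : ∫ x, mollifier n x = 1 := (shrinkingBump n).integral_normed

lemma integrable_mollifier (n : ℕ) : Integrable (mollifier n) :=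
  (contDiff_mollifier n (k := 0)).continuous.integrable_of_hasCompactSupport
    (hasCompactSupport_mollifier n)

lemma mollifier_eq_zero {n : ℕ} {x : R3} (hx : 1 / ((n : ℝ) + 1) ≤ ‖x‖) : mollifier n x = 0 := by
  have := (shrinkingBump n).support_normed_eq (μ := volume)
  by_contra h
  have : x ∈ Metric.ball (0 : R3) (shrinkingBump n).rOut := this ▸ h
  rw [mem_ball_zero_iff] at this
  exact absurd hx (not_le.2 this)

lemma mollify_apply (n : ℕ) (u : R3 → ℂ) (x : R3) :
    mollify n u x = ∫ y, mollifier n (x - y) • u y := by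
  rw [mollify, convolution_eq_swap]; rfl

lemma contDiff_mollify {u : R3 → ℂ} (hu : LocallyIntegrable u) (n : ℕ) :
    ContDiff ℝ (⊤ : ℕ∞) (mollify n u) :=
  (hasCompactSupport_mollifier n).contDiff_convolution_left _ (contDiff_mollifier n) hu

lemma ae_tendsto_mollify {u : R3 → ℂ} (hu : LocallyIntegrable u) :
    ∀ᵐ x, Tendsto (fun n => mollify n u x) atTop (𝓝 (u x)) := by
  -- The outer radius is exactly twice the inner one; this bounded ratio is what Lebesgue
  -- differentiation needs.
  refine ContDiffBump.ae_convolution_tendsto_right_of_locallyIntegrable (K := 2)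
    tendsto_rOut_shrinkingBump (Eventually.of_forall fun n => ?_) hu
  simp only [shrinkingBump]
  apply le_of_eq
  field_simp

/-- The derivative falls on the kernel, so the weak formulation can be applied with y ↦ `mollifier n
(x - y)` as test function. -/
lemma partialDeriv_mollify_apply {u : R3 → ℂ} (hu : LocallyIntegrable u) (n : ℕ) (i : Fin 3)
    (x : R3) : partialDeriv i (mollify n u) x
      = ∫ y, (fderiv ℝ (mollifier n) (x - y) (EuclideanSpace.single i 1)) • u y := by
  have h1 : ContDiff ℝ 1 (mollifier n) := contDiff_mollifier n (k := 1)
  have h := (hasCompactSupport_mollifier n).hasFDerivAt_convolution_left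
    (lsmul ℝ ℝ : ℝ →L[ℝ] ℂ →L[ℝ] ℂ) h1 hu x
  rw [partialDeriv]
  change (fderiv ℝ (mollifier n ⋆[lsmul ℝ ℝ, volume] u) x) _ = _
  rw [h.fderiv, convolution_eq_swap]
  have hc := ((hasCompactSupport_mollifier n).fderiv ℝ).convolutionExists_left
    ((lsmul ℝ ℝ : ℝ →L[ℝ] ℂ →L[ℝ] ℂ).precompL R3) (h1.continuous_fderiv one_ne_zero) hu x
  rw [ContinuousLinearMap.integral_apply hc.integrable_swap]
  rfl

lemma isTestFunction_mollifier_sub (n : ℕ) (x : R3) :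
    IsTestFunction (fun y => (mollifier n (x - y) : ℂ)) := by
  refine ⟨Complex.ofRealCLM.contDiff.comp
    ((contDiff_mollifier n).comp (contDiff_const.sub contDiff_id)), ?_⟩
  exact ((hasCompactSupport_mollifier n).comp_homeomorph (Homeomorph.subLeft x)).comp_left
    Complex.ofReal_zero

lemma partialDeriv_mollifier_sub (n : ℕ) (i : Fin 3) (x y : R3) :
    partialDeriv i (fun y => (mollifier n (x - y) : ℂ)) y
      = -(fderiv ℝ (mollifier n) (x - y) (EuclideanSpace.single i 1) : ℂ) := by
  have h1 : HasFDerivAt (mollifier n) (fderiv ℝ (mollifier n) (x - y)) (x - y) :=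
    ((contDiff_mollifier n (k := 1)).differentiable one_ne_zero _).hasFDerivAt
  have h2 : HasFDerivAt (fun y : R3 => x - y) (-ContinuousLinearMap.id ℝ R3) y :=
    (hasFDerivAt_id y).const_sub x
  have h3 := (Complex.ofRealCLM.hasFDerivAt).comp y (h1.comp y h2)
  rw [partialDeriv]
  erw [h3.fderiv]
  simp

/-- If the vector field `X` has weak divergence `-h`, mollification turns this into an identity
for the derivatives of the mollifications. -/
lemma sum_partialDeriv_mollify {X : Fin 3 → R3 → ℂ} {h : R3 → ℂ}
    (hX : ∀ i, LocallyIntegrable (X i))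
    (hdiv : ∀ φ, IsTestFunction φ → ∫ x, ∑ i, X i x * partialDeriv i φ x = ∫ x, h x * φ x)
    (n : ℕ) (x : R3) :
    ∑ i, partialDeriv i (mollify n (X i)) x = -mollify n h x := by
  have := hdiv _ (isTestFunction_mollifier_sub n x)
  simp only [partialDeriv_mollify_apply (hX _), mollify_apply]
  rw [← integral_finsetSum]
  · rw [← neg_eq_iff_eq_neg, ← integral_neg]
    simp only [partialDeriv_mollifier_sub] at this
    convert this using 2
    · ext y
      simp [mul_comm]
    · ext y
      simp [mul_comm]
  · intro i _
    have h1 : ContDiff ℝ 1 (mollifier n) := contDiff_mollifier n (k := 1)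
    have := (((hasCompactSupport_mollifier n).fderiv_apply ℝ (EuclideanSpace.single i 1))).convolutionExists_left
      (lsmul ℝ ℝ : ℝ →L[ℝ] ℂ →L[ℝ] ℂ) ((h1.continuous_fderiv one_ne_zero).clm_apply continuous_const) (hX i) x
    exact this.integrable_swap

lemma partialDeriv_mollify {i : Fin 3} {u U : R3 → ℂ} (h : HasWeakDeriv i u U) (n : ℕ) :
    partialDeriv i (mollify n u) = mollify n U := by
  ext x
  have := h.2.2 _ (isTestFunction_mollifier_sub n x)
  rw [partialDeriv_mollify_apply h.1, mollify_apply, ← neg_inj, ← integral_neg]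
  simp only [partialDeriv_mollifier_sub] at this
  refine Eq.trans (integral_congr_ae (.of_forall fun y => ?_))
    (this.trans (congrArg Neg.neg (integral_congr_ae (.of_forall fun y => ?_))))
  · simp [mul_comm]
  · simp [mul_comm]

lemma norm_mollify_le {u : R3 → ℂ} (n : ℕ) {C : ℝ} (hu : ∀ x, ‖u x‖ ≤ C) (x : R3) :
    ‖mollify n u x‖ ≤ C := by
  rw [mollify_apply]
  calc _ ≤ ∫ y, C * mollifier n (x - y) := by
        apply norm_integral_le_of_norm_le
        · exact ((integrable_mollifier n).comp_sub_left x).const_mul C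
        · refine Eventually.of_forall fun y => ?_
          rw [norm_smul, Real.norm_of_nonneg (mollifier_nonneg _ _), mul_comm]
          exact mul_le_mul_of_nonneg_right (hu y) (mollifier_nonneg _ _)
    _ = C := by
        rw [integral_const_mul, integral_sub_left_eq_self (fun y => mollifier n y),
          integral_mollifier, mul_one]

/-- All kernels live in the unit ball, where `u` oscillates by at most `K`. Uniformity in `n`
supplies the majorant for dominated convergence. -/
lemma norm_mollify_sub_le {u : R3 → ℂ} (n : ℕ) {K : NNReal} (hu : LipschitzWith K u) (x : R3) :
    ‖mollify n u x - u x‖ ≤ K := by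
  rw [← dist_eq_norm]
  refine ContDiffBump.dist_normed_convolution_le hu.continuous.aestronglyMeasurable fun y hy => ?_
  refine (hu.dist_le_mul y x).trans ?_
  have h1 : (shrinkingBump n).rOut ≤ 1 := by
    simp only [shrinkingBump]
    rw [div_le_one (by positivity)]
    linarith [(n.cast_nonneg : (0 : ℝ) ≤ n)]
  have h2 : dist y x ≤ 1 := (Metric.mem_ball.1 hy).le.trans h1
  exact mul_le_of_le_one_right K.2 h2

lemma mollify_eq_zero {u : R3 → ℂ} {R : ℝ} (hu : ∀ x, R < ‖x‖ → u x = 0) (n : ℕ) {x : R3}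
    (hx : R + 1 < ‖x‖) : mollify n u x = 0 := by
  rw [mollify_apply]
  apply integral_eq_zero_of_ae
  refine Eventually.of_forall fun y => ?_
  by_cases hy : R < ‖y‖
  · simp [hu y hy]
  · have h1 : 1 / ((n : ℝ) + 1) ≤ 1 := by
      rw [div_le_one (by positivity)]
      linarith [(n.cast_nonneg : (0 : ℝ) ≤ n)]
    have h2 := norm_sub_norm_le x y
    simp [mollifier_eq_zero (n := n) (x := x - y) (by linarith)]

end Mollification

/-! ### Lipschitz functions as multipliers of weak derivatives. -/

noncomputable section LipschitzMultipliers

open Filter Topology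

lemma norm_partialDeriv_le {σ : R3 → ℂ} {K : NNReal} (hσ : LipschitzWith K σ) (i : Fin 3)
    (x : R3) : ‖partialDeriv i σ x‖ ≤ K := by
  refine ((fderiv ℝ σ x).le_opNorm _).trans ?_
  simpa using norm_fderiv_le_of_lipschitz ℝ hσ (x₀ := x)

lemma measurable_partialDeriv (σ : R3 → ℂ) (i : Fin 3) : Measurable (partialDeriv i σ) :=
  measurable_fderiv_apply_const ℝ σ _

lemma locallyIntegrable_mul_of_bound {u m : R3 → ℂ} (hu : LocallyIntegrable u)
    (hm : AEStronglyMeasurable m) {C : ℝ} (hC : ∀ x, ‖m x‖ ≤ C) :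
    LocallyIntegrable (fun x => m x * u x) := fun x => by
  obtain ⟨s, hs, hi⟩ := hu x
  exact ⟨s, hs, hi.bdd_mul hm.restrict (.of_forall hC)⟩

lemma locallyIntegrable_continuous_mul {u m : R3 → ℂ} (hu : LocallyIntegrable u)
    (hm : Continuous m) : LocallyIntegrable (fun x => m x * u x) := by
  rw [← locallyIntegrableOn_univ] at hu ⊢
  exact hu.continuousOn_mul hm.continuousOn isOpen_univ.isLocallyClosed

lemma MeasureTheory.LocallyIntegrable.integrable_mul_hasCompactSupport {u φ : R3 → ℂ} (hu : LocallyIntegrable u)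
    (hφ : Continuous φ) (hc : HasCompactSupport φ) : Integrable (fun x => u x * φ x) := by
  simpa only [smul_eq_mul] using hu.integrable_smul_right_of_hasCompactSupport hφ hc

lemma locallyIntegrable_partialDeriv {σ : R3 → ℂ} {K : NNReal} (hσ : LipschitzWith K σ)
    (i : Fin 3) : LocallyIntegrable (partialDeriv i σ) := by
  have := locallyIntegrable_mul_of_bound (u := fun _ => (1 : ℂ)) continuous_const.locallyIntegrable
    (measurable_partialDeriv σ i).aestronglyMeasurable (norm_partialDeriv_le hσ i)
  simpa using this

lemma IsTestFunction.continuous {φ : R3 → ℂ} (hφ : IsTestFunction φ) : Continuous φ :=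
  hφ.1.continuous

lemma IsTestFunction.differentiable {φ : R3 → ℂ} (hφ : IsTestFunction φ) : Differentiable ℝ φ :=
  hφ.1.differentiable (by simp)

lemma IsTestFunction.continuous_partialDeriv {φ : R3 → ℂ} (hφ : IsTestFunction φ) (i : Fin 3) :
    Continuous (partialDeriv i φ) :=
  (hφ.1.continuous_fderiv (by simp)).clm_apply continuous_const

lemma IsTestFunction.hasCompactSupport_partialDeriv {φ : R3 → ℂ} (hφ : IsTestFunction φ)
    (i : Fin 3) : HasCompactSupport (partialDeriv i φ) :=
  hφ.2.fderiv_apply ℝ _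

lemma partialDeriv_mul {φ ψ : R3 → ℂ} {x : R3} (hφ : DifferentiableAt ℝ φ x)
    (hψ : DifferentiableAt ℝ ψ x) (i : Fin 3) :
    partialDeriv i (fun y => φ y * ψ y) x = partialDeriv i φ x * ψ x + φ x * partialDeriv i ψ x := by
  rw [partialDeriv, fderiv_fun_mul hφ hψ]
  simp [partialDeriv]
  ring

lemma IsTestFunction.mul {σ φ : R3 → ℂ} (hσ : ContDiff ℝ (⊤ : ℕ∞) σ) (hφ : IsTestFunction φ) :
    IsTestFunction (fun x => σ x * φ x) :=
  ⟨hσ.mul hφ.1, hφ.2.mul_left⟩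

/-- Integration by parts for line derivatives of Lipschitz functions; Rademacher's theorem
identifies these almost everywhere with the Fréchet derivative. -/
lemma LipschitzWith.integral_mul_fderiv_add_eq_zero {r p : R3 → ℝ} {C D : NNReal}
    (hr : LipschitzWith C r) (hp : LipschitzWith D p) (hp1 : ContDiff ℝ 1 p)
    (hc : HasCompactSupport p) (v : R3) :
    Integrable (fun x => r x * fderiv ℝ p x v + fderiv ℝ r x v * p x) ∧
      ∫ x, (r x * fderiv ℝ p x v + fderiv ℝ r x v * p x) = 0 := by
  have h1 : Integrable (fun x => r x * fderiv ℝ p x v) :=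
    (hr.continuous.mul ((hp1.continuous_fderiv one_ne_zero).clm_apply
      continuous_const)).integrable_of_hasCompactSupport (hc.fderiv_apply ℝ v).mul_left
  have h2 : Integrable (fun x => fderiv ℝ r x v * p x) := by
    refine (hp.continuous.integrable_of_hasCompactSupport hc).bdd_mul (c := C * ‖v‖)
      (measurable_fderiv_apply_const ℝ r v).aestronglyMeasurable (.of_forall fun x => ?_)
    exact ((fderiv ℝ r x).le_opNorm v).trans
      (mul_le_mul_of_nonneg_right (norm_fderiv_le_of_lipschitz ℝ hr) (norm_nonneg v))
  refine ⟨h1.add h2, ?_⟩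
  rw [integral_add h1 h2]
  have h3 := hr.integral_lineDeriv_mul_eq (μ := volume) hp hc v
  have h4 : ∫ x, lineDeriv ℝ r x v * p x = ∫ x, fderiv ℝ r x v * p x := by
    refine integral_congr_ae ?_
    filter_upwards [hr.ae_differentiableAt] with x hx
    rw [hx.lineDeriv_eq_fderiv]
  have h5 : ∫ x, lineDeriv ℝ p x (-v) * r x = -∫ x, r x * fderiv ℝ p x v := by
    rw [← integral_neg]
    refine integral_congr_ae (.of_forall fun x => ?_)
    simp only [(hp1.differentiable one_ne_zero x).lineDeriv_eq_fderiv, map_neg]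
    ring
  rw [← h4, h3, h5, add_neg_cancel]

lemma partialDeriv_eq_re_add_im {σ : R3 → ℂ} {x : R3} (h : DifferentiableAt ℝ σ x) (i : Fin 3) :
    partialDeriv i σ x = (fderiv ℝ (fun y => (σ y).re) x (EuclideanSpace.single i 1) : ℝ)
      + Complex.I * (fderiv ℝ (fun y => (σ y).im) x (EuclideanSpace.single i 1) : ℝ) := by
  have h1 : HasFDerivAt (fun y => (σ y).re) _ x := Complex.reCLM.hasFDerivAt.comp x h.hasFDerivAt
  have h2 : HasFDerivAt (fun y => (σ y).im) _ x := Complex.imCLM.hasFDerivAt.comp x h.hasFDerivAt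
  rw [h1.fderiv, h2.fderiv, partialDeriv, mul_comm]
  exact (Complex.re_add_im _).symm

lemma LipschitzWith.complex_re {σ : R3 → ℂ} {K : NNReal} (hσ : LipschitzWith K σ) :
    LipschitzWith K (fun x => (σ x).re) :=
  LipschitzWith.of_dist_le_mul fun x y => by
    refine le_trans ?_ (hσ.dist_le_mul x y)
    rw [dist_eq_norm, dist_eq_norm, ← Complex.sub_re]
    exact Complex.abs_re_le_norm _

lemma LipschitzWith.complex_im {σ : R3 → ℂ} {K : NNReal} (hσ : LipschitzWith K σ) :
    LipschitzWith K (fun x => (σ x).im) :=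
  LipschitzWith.of_dist_le_mul fun x y => by
    refine le_trans ?_ (hσ.dist_le_mul x y)
    rw [dist_eq_norm, dist_eq_norm, ← Complex.sub_im]
    exact Complex.abs_im_le_norm _

/-- The classical derivative of a Lipschitz function is its weak derivative. -/
lemma LipschitzWith.hasWeakDeriv {σ : R3 → ℂ} {K : NNReal} (hσ : LipschitzWith K σ) (i : Fin 3) :
    HasWeakDeriv i σ (partialDeriv i σ) := by
  refine ⟨hσ.continuous.locallyIntegrable, locallyIntegrable_partialDeriv hσ i, fun φ hφ => ?_⟩
  have hφ1 : ContDiff ℝ 1 φ := hφ.1.of_le (by exact_mod_cast le_top)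
  obtain ⟨D, hD⟩ := hφ1.lipschitzWith_of_hasCompactSupport hφ.2 one_ne_zero
  have hre : ContDiff ℝ 1 (fun x => (φ x).re) := Complex.reCLM.contDiff.comp hφ1
  have him : ContDiff ℝ 1 (fun x => (φ x).im) := Complex.imCLM.contDiff.comp hφ1
  have cre : HasCompactSupport (fun x => (φ x).re) := hφ.2.comp_left Complex.zero_re
  have cim : HasCompactSupport (fun x => (φ x).im) := hφ.2.comp_left Complex.zero_im
  -- The complex product splits into four real ones: re·re - im·im for the real part, re·im + im·re
  -- for the imaginary part.
  obtain ⟨a1, a2⟩ := hσ.complex_re.integral_mul_fderiv_add_eq_zero hD.complex_re hre cre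
    (EuclideanSpace.single i 1)
  obtain ⟨b1, b2⟩ := hσ.complex_im.integral_mul_fderiv_add_eq_zero hD.complex_im him cim
    (EuclideanSpace.single i 1)
  obtain ⟨c1, c2⟩ := hσ.complex_re.integral_mul_fderiv_add_eq_zero hD.complex_im him cim
    (EuclideanSpace.single i 1)
  obtain ⟨d1, d2⟩ := hσ.complex_im.integral_mul_fderiv_add_eq_zero hD.complex_re hre cre
    (EuclideanSpace.single i 1)
  have i1 : Integrable (fun x => σ x * partialDeriv i φ x) :=
    hσ.continuous.locallyIntegrable.integrable_mul_hasCompactSupport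
      (hφ.continuous_partialDeriv i) (hφ.hasCompactSupport_partialDeriv i)
  have i2 : Integrable (fun x => partialDeriv i σ x * φ x) :=
    (locallyIntegrable_partialDeriv hσ i).integrable_mul_hasCompactSupport hφ.continuous hφ.2
  rw [← add_eq_zero_iff_eq_neg, ← integral_add i1 i2]
  have i12 : Integrable (fun x => σ x * partialDeriv i φ x + partialDeriv i σ x * φ x) := i1.add i2
  apply Complex.ext
  · rw [← Complex.reCLM_apply, ← Complex.reCLM.integral_comp_comm i12, Complex.zero_re,
      ← sub_zero 0]
    nth_rw 1 [← a2]
    rw [← b2, ← integral_sub a1 b1]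
    refine integral_congr_ae ?_
    filter_upwards [hσ.ae_differentiableAt] with x hx
    rw [partialDeriv_eq_re_add_im hx, partialDeriv_eq_re_add_im (hφ.differentiable x)]
    simp
    ring
  · rw [← Complex.imCLM_apply, ← Complex.imCLM.integral_comp_comm i12, Complex.zero_im,
      ← add_zero 0]
    nth_rw 1 [← c2]
    rw [← d2, ← integral_add c1 d1]
    refine integral_congr_ae ?_
    filter_upwards [hσ.ae_differentiableAt] with x hx
    rw [partialDeriv_eq_re_add_im hx, partialDeriv_eq_re_add_im (hφ.differentiable x)]
    simp
    ring

/-- Multiplication of a vector field with weak divergence `-h` by a Lipschitz function. -/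
lemma integral_sum_lipschitz_mul {X : Fin 3 → R3 → ℂ} {h : R3 → ℂ}
    (hX : ∀ i, LocallyIntegrable (X i)) (hh : LocallyIntegrable h)
    (hdiv : ∀ φ, IsTestFunction φ → ∫ x, ∑ i, X i x * partialDeriv i φ x = ∫ x, h x * φ x)
    {σ : R3 → ℂ} {K : NNReal} (hσ : LipschitzWith K σ) {φ : R3 → ℂ} (hφ : IsTestFunction φ) :
    ∫ x, ∑ i, (σ x * X i x) * partialDeriv i φ x
      = ∫ x, (σ x * h x - ∑ i, X i x * partialDeriv i σ x) * φ x := by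
  have hσl : LocallyIntegrable σ := hσ.continuous.locallyIntegrable
  -- The product of `σ` and `φ` is not smooth, so the divergence identity is tested with the
  -- mollified `σ` times `φ`. The bounds `hb` and `hb'` do not depend on `n` and allow the passage
  -- to the limit.
  have hsm : ∀ n, ContDiff ℝ (⊤ : ℕ∞) (mollify n σ) := contDiff_mollify hσl
  have hb : ∀ n x, ‖mollify n σ x‖ ≤ ‖σ x‖ + K := fun n x => by
    have := norm_mollify_sub_le n hσ x
    have := norm_sub_norm_le (mollify n σ x) (σ x)
    linarith
  have hb' : ∀ n i x, ‖partialDeriv i (mollify n σ) x‖ ≤ K := fun n i x => by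
    rw [partialDeriv_mollify (hσ.hasWeakDeriv i)]
    exact norm_mollify_le n (norm_partialDeriv_le hσ i) x
  have hconv := ae_tendsto_mollify hσl
  have hconv' : ∀ᵐ x, ∀ i, Tendsto (fun n => partialDeriv i (mollify n σ) x) atTop
      (𝓝 (partialDeriv i σ x)) := by
    rw [ae_all_iff]
    intro i
    filter_upwards [ae_tendsto_mollify (locallyIntegrable_partialDeriv hσ i)] with x hx
    simpa only [partialDeriv_mollify (hσ.hasWeakDeriv i)] using hx
  have hXφ : ∀ i, Integrable (fun x => ‖X i x * φ x‖) := fun i =>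
    ((hX i).integrable_mul_hasCompactSupport hφ.continuous hφ.2).norm
  have hXφ' : ∀ i, Integrable (fun x => ‖X i x * ((‖σ x‖ + K : ℝ) * partialDeriv i φ x)‖) :=
    fun i => ((hX i).integrable_mul_hasCompactSupport
      ((Complex.continuous_ofReal.comp (hσ.continuous.norm.add continuous_const)).mul
        (hφ.continuous_partialDeriv i)) (hφ.hasCompactSupport_partialDeriv i).mul_left).norm
  have hXm : ∀ i, AEStronglyMeasurable (X i) := fun i => (hX i).aestronglyMeasurable
  have e : ∀ n, ∫ x, ∑ i, X i x * (partialDeriv i (mollify n σ) x * φ x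
      + mollify n σ x * partialDeriv i φ x) = ∫ x, h x * (mollify n σ x * φ x) := fun n => by
    rw [← hdiv _ (IsTestFunction.mul (hsm n) hφ)]
    refine integral_congr_ae (.of_forall fun x => Finset.sum_congr rfl fun i _ => ?_)
    rw [partialDeriv_mul ((hsm n).differentiable (by simp) x) (hφ.differentiable x)]
  have l1 : Tendsto (fun n => ∫ x, ∑ i, X i x * (partialDeriv i (mollify n σ) x * φ x
      + mollify n σ x * partialDeriv i φ x)) atTop
      (𝓝 (∫ x, ∑ i, X i x * (partialDeriv i σ x * φ x + σ x * partialDeriv i φ x))) := by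
    refine tendsto_integral_of_dominated_convergence
      (fun x => ∑ i, (K * ‖X i x * φ x‖ + ‖X i x * ((‖σ x‖ + K : ℝ) * partialDeriv i φ x)‖))
      (fun n => ?_) (integrable_finsetSum _ fun i _ => ((hXφ i).const_mul _).add (hXφ' i))
      (fun n => .of_forall fun x => ?_) ?_
    · refine Finset.aestronglyMeasurable_fun_sum _ fun i _ => (hXm i).mul ?_
      exact ((measurable_partialDeriv _ i).aestronglyMeasurable.mul
        hφ.continuous.aestronglyMeasurable).add ((hsm n).continuous.mul
        (hφ.continuous_partialDeriv i)).aestronglyMeasurable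
    · refine norm_sum_le_of_le _ fun i _ => ?_
      rw [mul_add]
      refine norm_add_le_of_le ?_ ?_
      · rw [norm_mul, norm_mul, norm_mul, mul_left_comm]
        exact mul_le_mul_of_nonneg_right (hb' n i x) (by positivity)
      · rw [norm_mul, norm_mul, norm_mul, norm_mul, Complex.norm_real,
          Real.norm_of_nonneg (by positivity)]
        gcongr
        exact hb n x
    · filter_upwards [hconv, hconv'] with x h1 h2
      exact tendsto_finsetSum _ fun i _ =>
        (((h2 i).mul_const _).add (h1.mul_const _)).const_mul _
  have l2 : Tendsto (fun n => ∫ x, h x * (mollify n σ x * φ x)) atTop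
      (𝓝 (∫ x, h x * (σ x * φ x))) := by
    refine tendsto_integral_of_dominated_convergence
      (fun x => ‖h x * ((‖σ x‖ + K : ℝ) * φ x)‖) (fun n => ?_)
      (hh.integrable_mul_hasCompactSupport ((Complex.continuous_ofReal.comp
        (hσ.continuous.norm.add continuous_const)).mul hφ.continuous) hφ.2.mul_left).norm
      (fun n => .of_forall fun x => ?_) ?_
    · exact hh.aestronglyMeasurable.mul
        ((hsm n).continuous.mul hφ.continuous).aestronglyMeasurable
    · rw [norm_mul, norm_mul, norm_mul, norm_mul, Complex.norm_real,
        Real.norm_of_nonneg (by positivity)]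
      gcongr
      exact hb n x
    · filter_upwards [hconv] with x h1
      exact (h1.mul_const _).const_mul _
  have key := tendsto_nhds_unique (l1.congr e) l2
  have i1 : Integrable (fun x => ∑ i, (σ x * X i x) * partialDeriv i φ x) :=
    integrable_finsetSum _ fun i _ => (locallyIntegrable_continuous_mul (hX i)
      hσ.continuous).integrable_mul_hasCompactSupport (hφ.continuous_partialDeriv i)
      (hφ.hasCompactSupport_partialDeriv i)
  have i2 : ∀ i, Integrable (fun x => (partialDeriv i σ x * X i x) * φ x) := fun i =>
    (locallyIntegrable_mul_of_bound (hX i) (measurable_partialDeriv σ i).aestronglyMeasurable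
      (norm_partialDeriv_le hσ i)).integrable_mul_hasCompactSupport hφ.continuous hφ.2
  have i2' : Integrable (fun x => ∑ i, (partialDeriv i σ x * X i x) * φ x) :=
    integrable_finsetSum _ fun i _ => i2 i
  have i3 : Integrable (fun x => (σ x * h x) * φ x) :=
    (locallyIntegrable_continuous_mul hh hσ.continuous).integrable_mul_hasCompactSupport
      hφ.continuous hφ.2
  have k1 : ∫ x, ∑ i, X i x * (partialDeriv i σ x * φ x + σ x * partialDeriv i φ x)
      = (∫ x, ∑ i, (partialDeriv i σ x * X i x) * φ x)
        + ∫ x, ∑ i, (σ x * X i x) * partialDeriv i φ x := by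
    rw [← integral_add i2' i1]
    refine integral_congr_ae (.of_forall fun x => ?_)
    refine (Finset.sum_congr rfl fun i _ => ?_).trans Finset.sum_add_distrib
    ring
  have k2 : ∫ x, (σ x * h x - ∑ i, X i x * partialDeriv i σ x) * φ x
      = (∫ x, (σ x * h x) * φ x) - ∫ x, ∑ i, (partialDeriv i σ x * X i x) * φ x := by
    rw [← integral_sub i3 i2']
    refine integral_congr_ae (.of_forall fun x => ?_)
    simp only [sub_mul, Finset.sum_mul]
    congr 1
    exact Finset.sum_congr rfl fun i _ => by ring
  have k3 : ∫ x, h x * (σ x * φ x) = ∫ x, (σ x * h x) * φ x :=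
    integral_congr_ae (.of_forall fun x => by ring)
  rw [k2, ← k3, ← key, k1]
  ring

/-- The product rule for a weakly differentiable and a Lipschitz function. -/
lemma HasWeakDeriv.lipschitz_mul {i : Fin 3} {u U σ : R3 → ℂ} (hu : HasWeakDeriv i u U)
    {K : NNReal} (hσ : LipschitzWith K σ) :
    HasWeakDeriv i (fun x => σ x * u x) (fun x => σ x * U x + partialDeriv i σ x * u x) := by
  refine ⟨locallyIntegrable_continuous_mul hu.1 hσ.continuous,
    (locallyIntegrable_continuous_mul hu.2.1 hσ.continuous).add (locallyIntegrable_mul_of_bound hu.1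
      (measurable_partialDeriv σ i).aestronglyMeasurable (norm_partialDeriv_le hσ i)),
    fun φ hφ => ?_⟩
  -- A field whose only nonzero component is `u` in direction `i` has weak divergence `U`, so the
  -- product rule is a case of the divergence lemma.
  have := integral_sum_lipschitz_mul (X := fun j => if j = i then u else 0) (h := -U)
    (fun j => by
      split_ifs
      exacts [hu.1, locallyIntegrable_zero]) hu.2.1.neg (fun ψ hψ => ?_) hσ hφ
  · rw [← integral_neg]
    convert this using 3 with x x
    · rw [Finset.sum_eq_single i] <;> simp +contextual
    · rw [Finset.sum_eq_single i] <;> simp +contextual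
      ring
  · have h1 : (∫ x, (-U) x * ψ x) = ∫ x, u x * partialDeriv i ψ x := by
      rw [hu.2.2 ψ hψ, ← integral_neg]
      simp
    rw [h1]
    refine integral_congr_ae (.of_forall fun x => ?_)
    simp only
    rw [Finset.sum_eq_single i] <;> simp +contextual

end LipschitzMultipliers

/-! ### The Carleman estimate for smooth compactly supported functions. -/

noncomputable section SmoothCarleman

/-- The classical partial derivative of a real-valued function on `R3`. -/
def realPartialDeriv (i : Fin 3) (f : R3 → ℝ) (x : R3) : ℝ :=
  fderiv ℝ f x (EuclideanSpace.single i 1)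

lemma realPartialDeriv_mul {f g : R3 → ℝ} (hf : Differentiable ℝ f) (hg : Differentiable ℝ g)
    (i : Fin 3) (x : R3) : realPartialDeriv i (fun y => f y * g y) x
      = realPartialDeriv i f x * g x + f x * realPartialDeriv i g x := by
  rw [realPartialDeriv, fderiv_fun_mul (hf x) (hg x)]
  simp [realPartialDeriv]
  ring

lemma realPartialDeriv_add {f g : R3 → ℝ} (hf : Differentiable ℝ f) (hg : Differentiable ℝ g)
    (i : Fin 3) (x : R3) : realPartialDeriv i (fun y => f y + g y) x
      = realPartialDeriv i f x + realPartialDeriv i g x := by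
  rw [realPartialDeriv, fderiv_fun_add (hf x) (hg x)]
  rfl

lemma realPartialDeriv_const_mul {f : R3 → ℝ} (hf : Differentiable ℝ f) (c : ℝ)
    (i : Fin 3) (x : R3) : realPartialDeriv i (fun y => c * f y) x = c * realPartialDeriv i f x := by
  rw [realPartialDeriv, fderiv_const_mul (hf x)]
  rfl

lemma realPartialDeriv_coord (i j : Fin 3) (x : R3) :
    realPartialDeriv i (fun y : R3 => y j) x = if i = j then 1 else 0 := by
  have : HasFDerivAt (fun y : R3 => y j) (EuclideanSpace.proj j : R3 →L[ℝ] ℝ) x :=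
    (EuclideanSpace.proj j : R3 →L[ℝ] ℝ).hasFDerivAt
  rw [realPartialDeriv, this.fderiv]
  simp [eq_comm]

lemma differentiable_coord (j : Fin 3) : Differentiable ℝ (fun y : R3 => y j) :=
  (EuclideanSpace.proj j : R3 →L[ℝ] ℝ).differentiable

lemma contDiff_realPartialDeriv {f : R3 → ℝ} (hf : ContDiff ℝ (⊤ : ℕ∞) f) (i : Fin 3) :
    ContDiff ℝ (⊤ : ℕ∞) (realPartialDeriv i f) :=
  (hf.fderiv_right (m := (⊤ : ℕ∞)) (by simp)).clm_apply contDiff_const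

lemma realPartialDeriv_comm {f : R3 → ℝ} (hf : ContDiff ℝ (⊤ : ℕ∞) f) (i j : Fin 3) (x : R3) :
    realPartialDeriv i (realPartialDeriv j f) x = realPartialDeriv j (realPartialDeriv i f) x := by
  have h2 : ContDiff ℝ 1 (fderiv ℝ f) := hf.fderiv_right (m := 1) (by norm_cast)
  have hs : IsSymmSndFDerivAt ℝ f x :=
    (contDiff_infty.1 hf 2).contDiffAt.isSymmSndFDerivAt (by simp)
  have h (i j : Fin 3) : realPartialDeriv i (realPartialDeriv j f) x
      = fderiv ℝ (fderiv ℝ f) x (EuclideanSpace.single i 1) (EuclideanSpace.single j 1) := by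
    have := (h2.differentiable one_ne_zero x).hasFDerivAt.clm_apply
      (hasFDerivAt_const (EuclideanSpace.single j (1 : ℝ) : R3) x)
    rw [realPartialDeriv]
    change fderiv ℝ (fun y => fderiv ℝ f y (EuclideanSpace.single j 1)) x _ = _
    rw [this.fderiv]
    simp
  rw [h, h]
  exact hs _ _

lemma realPartialDeriv_eq_zero {f : R3 → ℝ} {K : Set R3} (hK : IsClosed K)
    (hf : ∀ x, x ∉ K → f x = 0) (i : Fin 3) {x : R3} (hx : x ∉ K) :
    realPartialDeriv i f x = 0 := by
  have : f =ᶠ[nhds x] fun _ => 0 := by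
    filter_upwards [hK.isOpen_compl.mem_nhds hx] with y hy using hf y hy
  rw [realPartialDeriv, this.fderiv_eq]
  simp

lemma Continuous.integrable_of_eq_zero {f : R3 → ℝ} {K : Set R3} (hf : Continuous f)
    (hK : IsCompact K) (h : ∀ x, x ∉ K → f x = 0) : Integrable f :=
  hf.integrable_of_hasCompactSupport (HasCompactSupport.intro hK h)

lemma integral_realPartialDeriv_eq_zero {f : R3 → ℝ} {K : Set R3} (hf : ContDiff ℝ (⊤ : ℕ∞) f)
    (hK : IsCompact K) (h : ∀ x, x ∉ K → f x = 0) (i : Fin 3) :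
    ∫ x, realPartialDeriv i f x = 0 := by
  have i1 := hf.continuous.integrable_of_eq_zero hK h
  have i2 := (contDiff_realPartialDeriv hf i).continuous.integrable_of_eq_zero hK
    fun x => realPartialDeriv_eq_zero hK.isClosed h i
  have := integral_mul_fderiv_eq_neg_fderiv_mul_of_integrable (μ := volume) (𝕜 := ℝ)
    (f := fun _ : R3 => (1 : ℝ)) (g := f) (v := EuclideanSpace.single i 1) (by simp)
    (by simp only [one_mul]; exact i2) (by simpa using i1) (fun _ _ => differentiableAt_const _)
    (fun _ _ => hf.differentiable (by simp) _)
  simp only [one_mul, fderiv_fun_const, Pi.zero_apply, zero_apply, zero_mul,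
    integral_zero, neg_zero] at this
  exact this

/-- The ground state bound for the harmonic oscillator: expand |∇v + τxv|² ≥ 0 and use that div(x
v²) = 3v² + 2v x·∇v has integral zero. -/
lemma integral_sum_realPartialDeriv_sq_ge {v : R3 → ℝ} {K : Set R3} (hv : ContDiff ℝ (⊤ : ℕ∞) v)
    (hK : IsCompact K) (h0 : ∀ x, x ∉ K → v x = 0) {τ : ℝ} :
    3 * τ * ∫ x, v x ^ 2 ≤ ∫ x, ∑ i, (realPartialDeriv i v x ^ 2 + τ ^ 2 * x i ^ 2 * v x ^ 2) := by
  have hd : Differentiable ℝ v := hv.differentiable (by simp)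
  have hvc := hv.continuous
  have hc : ∀ i, Continuous (realPartialDeriv i v) := fun i =>
    (contDiff_realPartialDeriv hv i).continuous
  have hW : ∀ i : Fin 3, ContDiff ℝ (⊤ : ℕ∞) (fun x : R3 => x i * (v x * v x)) := fun i => by
    fun_prop
  have hz : ∀ i x, x ∉ K → realPartialDeriv i v x = 0 := fun i x =>
    realPartialDeriv_eq_zero hK.isClosed h0 i
  have hW0 : ∀ (i : Fin 3) x, x ∉ K → x i * (v x * v x) = 0 := fun i x hx => by simp [h0 x hx]
  have e : ∫ x, ∑ i, realPartialDeriv i (fun x : R3 => x i * (v x * v x)) x = 0 := by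
    rw [integral_finsetSum]
    · exact Finset.sum_eq_zero fun i _ => integral_realPartialDeriv_eq_zero (hW i) hK (hW0 i) i
    · exact fun i _ => (contDiff_realPartialDeriv (hW i) i).continuous.integrable_of_eq_zero hK
        fun x => realPartialDeriv_eq_zero hK.isClosed (hW0 i) i
  have e2 : ∀ x, ∑ i, realPartialDeriv i (fun x : R3 => x i * (v x * v x)) x
      = 3 * v x ^ 2 + 2 * v x * ∑ i, x i * realPartialDeriv i v x := fun x => by
    simp only [realPartialDeriv_mul (differentiable_coord _) (hd.fun_mul hd),
      realPartialDeriv_mul hd hd, realPartialDeriv_coord, Fin.sum_univ_three, if_true]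
    ring
  have i1 : Integrable (fun x => ∑ i, (realPartialDeriv i v x ^ 2 + τ ^ 2 * x i ^ 2 * v x ^ 2)) :=
    Continuous.integrable_of_eq_zero (by fun_prop) hK fun x hx => by simp [h0 x hx, hz _ x hx]
  have i2 : Integrable (fun x => v x ^ 2) :=
    Continuous.integrable_of_eq_zero (by fun_prop) hK fun x hx => by simp [h0 x hx]
  have i3 : Integrable (fun x => 3 * v x ^ 2 + 2 * v x * ∑ i, x i * realPartialDeriv i v x) :=
    Continuous.integrable_of_eq_zero (by fun_prop) hK fun x hx => by simp [h0 x hx]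
  simp only [e2] at e
  have : ∫ x, (3 * τ * v x ^ 2
      - τ * (3 * v x ^ 2 + 2 * v x * ∑ i, x i * realPartialDeriv i v x)) ≤
      ∫ x, ∑ i, (realPartialDeriv i v x ^ 2 + τ ^ 2 * x i ^ 2 * v x ^ 2) := by
    refine integral_mono ((i2.const_mul _).sub (i3.const_mul _)) i1 fun x => ?_
    simp only [Fin.sum_univ_three]
    nlinarith [sq_nonneg (realPartialDeriv 0 v x + τ * x 0 * v x),
      sq_nonneg (realPartialDeriv 1 v x + τ * x 1 * v x),
      sq_nonneg (realPartialDeriv 2 v x + τ * x 2 * v x)]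
  rw [integral_sub (i2.const_mul _) (i3.const_mul _), integral_const_mul, integral_const_mul, e]
    at this
  linarith

/-- The commutator identity for the conjugated Laplacian with Gaussian weight. -/
lemma integral_symm_mul_skew {v : R3 → ℝ} {K : Set R3} (hv : ContDiff ℝ (⊤ : ℕ∞) v)
    (hK : IsCompact K) (h0 : ∀ x, x ∉ K → v x = 0) (τ : ℝ) :
    ∫ x, 2 * (∑ i, (realPartialDeriv i (realPartialDeriv i v) x + τ ^ 2 * x i ^ 2 * v x))
        * (-2 * τ * (∑ i, x i * realPartialDeriv i v x) - 3 * τ * v x)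
      = 4 * τ * ∫ x, ∑ i, (realPartialDeriv i v x ^ 2 + τ ^ 2 * x i ^ 2 * v x ^ 2) := by
  have hd : Differentiable ℝ v := hv.differentiable (by simp)
  have hvc := hv.continuous
  have hs : ∀ i, ContDiff ℝ (⊤ : ℕ∞) (realPartialDeriv i v) := contDiff_realPartialDeriv hv
  have hd1 : ∀ i, Differentiable ℝ (realPartialDeriv i v) := fun i =>
    (hs i).differentiable (by simp)
  have hc : ∀ i, Continuous (realPartialDeriv i v) := fun i => (hs i).continuous
  have hc2 : ∀ i j, Continuous (realPartialDeriv j (realPartialDeriv i v)) := fun i j =>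
    (contDiff_realPartialDeriv (hs i) j).continuous
  have hz : ∀ i x, x ∉ K → realPartialDeriv i v x = 0 := fun i x =>
    realPartialDeriv_eq_zero hK.isClosed h0 i
  have hz2 : ∀ i j x, x ∉ K → realPartialDeriv j (realPartialDeriv i v) x = 0 := fun i j x =>
    realPartialDeriv_eq_zero hK.isClosed (hz i) j
  have hx := differentiable_coord
  set E : R3 → ℝ := fun x => x 0 * realPartialDeriv 0 v x + (x 1 * realPartialDeriv 1 v x
    + x 2 * realPartialDeriv 2 v x) with hE
  set N : R3 → ℝ := fun x => realPartialDeriv 0 v x * realPartialDeriv 0 v x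
    + (realPartialDeriv 1 v x * realPartialDeriv 1 v x
    + realPartialDeriv 2 v x * realPartialDeriv 2 v x) with hN
  set r : R3 → ℝ := fun x => x 0 * x 0 + (x 1 * x 1 + x 2 * x 2) with hr
  have sE : ContDiff ℝ (⊤ : ℕ∞) E := by fun_prop
  have sN : ContDiff ℝ (⊤ : ℕ∞) N := by fun_prop
  have sr : ContDiff ℝ (⊤ : ℕ∞) r := by fun_prop
  have dE : Differentiable ℝ E := sE.differentiable (by simp)
  have dN : Differentiable ℝ N := sN.differentiable (by simp)
  have dr : Differentiable ℝ r := sr.differentiable (by simp)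
  -- The difference of the two integrands is the divergence of this field. The first two terms form
  -- the Pohozaev (Rellich) field for Δv · x·∇v, the third handles v Δv, and the last handles |x|² v
  -- x·∇v.
  set W : Fin 3 → R3 → ℝ := fun i x => -4 * τ * (realPartialDeriv i v x * E x)
    + (2 * τ * (x i * N x) + (-6 * τ * (realPartialDeriv i v x * v x)
    + -2 * τ ^ 3 * (r x * (x i * (v x * v x))))) with hW
  have sW : ∀ i, ContDiff ℝ (⊤ : ℕ∞) (W i) := fun i => by fun_prop
  have W0 : ∀ i x, x ∉ K → W i x = 0 := fun i x hx => by
    simp [hW, hE, hN, hz _ x hx, h0 x hx]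
  have e : ∫ x, ∑ i, realPartialDeriv i (W i) x = 0 := by
    rw [integral_finsetSum]
    · exact Finset.sum_eq_zero fun i _ => integral_realPartialDeriv_eq_zero (sW i) hK (W0 i) i
    · exact fun i _ => (contDiff_realPartialDeriv (sW i) i).continuous.integrable_of_eq_zero hK
        fun x => realPartialDeriv_eq_zero hK.isClosed (W0 i) i
  have pE : ∀ i x, realPartialDeriv i E x = realPartialDeriv i v x
      + ∑ j, x j * realPartialDeriv i (realPartialDeriv j v) x := fun i x => by
    rw [hE, realPartialDeriv_add ((hx _).fun_mul (hd1 _)) (((hx _).fun_mul (hd1 _)).fun_add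
      ((hx _).fun_mul (hd1 _))), realPartialDeriv_add ((hx _).fun_mul (hd1 _))
      ((hx _).fun_mul (hd1 _))]
    simp only [realPartialDeriv_mul (hx _) (hd1 _), realPartialDeriv_coord, Fin.sum_univ_three]
    fin_cases i <;> simp <;> ring
  have pN : ∀ i x, realPartialDeriv i N x = 2 * ∑ j, realPartialDeriv j v x
      * realPartialDeriv i (realPartialDeriv j v) x := fun i x => by
    rw [hN, realPartialDeriv_add ((hd1 _).fun_mul (hd1 _)) (((hd1 _).fun_mul (hd1 _)).fun_add
      ((hd1 _).fun_mul (hd1 _))), realPartialDeriv_add ((hd1 _).fun_mul (hd1 _))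
      ((hd1 _).fun_mul (hd1 _))]
    simp only [realPartialDeriv_mul (hd1 _) (hd1 _), Fin.sum_univ_three]
    ring
  have pr : ∀ i x, realPartialDeriv i r x = 2 * x i := fun i x => by
    rw [hr, realPartialDeriv_add ((hx _).fun_mul (hx _)) (((hx _).fun_mul (hx _)).fun_add
      ((hx _).fun_mul (hx _))), realPartialDeriv_add ((hx _).fun_mul (hx _))
      ((hx _).fun_mul (hx _))]
    simp only [realPartialDeriv_mul (hx _) (hx _), realPartialDeriv_coord]
    fin_cases i <;> simp <;> ring
  have pW : ∀ x, ∑ i, realPartialDeriv i (W i) x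
      = 2 * (∑ i, (realPartialDeriv i (realPartialDeriv i v) x + τ ^ 2 * x i ^ 2 * v x))
        * (-2 * τ * (∑ i, x i * realPartialDeriv i v x) - 3 * τ * v x)
      - 4 * τ * ∑ i, (realPartialDeriv i v x ^ 2 + τ ^ 2 * x i ^ 2 * v x ^ 2) := fun x => by
    have p : ∀ i, realPartialDeriv i (W i) x = -4 * τ * (realPartialDeriv i (realPartialDeriv i v) x
        * E x + realPartialDeriv i v x * realPartialDeriv i E x) + (2 * τ * (N x
        + x i * realPartialDeriv i N x) + (-6 * τ * (realPartialDeriv i (realPartialDeriv i v) x * v x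
        + realPartialDeriv i v x * realPartialDeriv i v x) + -2 * τ ^ 3 *
        (realPartialDeriv i r x * (x i * (v x * v x)) + r x * ((v x * v x)
        + x i * (realPartialDeriv i v x * v x + v x * realPartialDeriv i v x))))) := fun i => by
      rw [hW]
      dsimp only
      rw [realPartialDeriv_add, realPartialDeriv_add, realPartialDeriv_add,
        realPartialDeriv_const_mul, realPartialDeriv_const_mul, realPartialDeriv_const_mul,
        realPartialDeriv_const_mul, realPartialDeriv_mul (hd1 i) dE, realPartialDeriv_mul (hx i) dN,
        realPartialDeriv_mul (hd1 i) hd, realPartialDeriv_mul dr, realPartialDeriv_mul (hx i),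
        realPartialDeriv_mul hd hd, realPartialDeriv_coord]
      · simp
      all_goals fun_prop
    simp only [p, pE, pN, pr]
    simp only [hE, hN, hr, Fin.sum_univ_three]
    -- Symmetry of the Hessian makes ∇v·∇(x·∇v) equal to |∇v|² + x·∇|∇v|²/2, so the second order
    -- terms of the Pohozaev field cancel.
    rw [realPartialDeriv_comm hv 1 0, realPartialDeriv_comm hv 2 0, realPartialDeriv_comm hv 2 1]
    ring
  have i1 : Integrable (fun x => 2 * (∑ i, (realPartialDeriv i (realPartialDeriv i v) x
      + τ ^ 2 * x i ^ 2 * v x)) * (-2 * τ * (∑ i, x i * realPartialDeriv i v x) - 3 * τ * v x)) :=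
    Continuous.integrable_of_eq_zero (by fun_prop) hK fun x hx => by
      simp [h0 x hx, hz2 _ _ x hx]
  have i2 : Integrable (fun x => ∑ i, (realPartialDeriv i v x ^ 2 + τ ^ 2 * x i ^ 2 * v x ^ 2)) :=
    Continuous.integrable_of_eq_zero (by fun_prop) hK fun x hx => by simp [h0 x hx, hz _ x hx]
  simp only [pW] at e
  rw [integral_sub i1 (i2.const_mul _), integral_const_mul] at e
  linarith

/-- The Gaussian weight `exp (τ |x|² / 2)`. -/
def gaussianWeight (τ : ℝ) (x : R3) : ℝ := Real.exp (τ / 2 * ‖x‖ ^ 2)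

lemma contDiff_gaussianWeight (τ : ℝ) : ContDiff ℝ (⊤ : ℕ∞) (gaussianWeight τ) :=
  (contDiff_const.mul (contDiff_norm_sq ℝ)).exp

lemma gaussianWeight_pos (τ : ℝ) (x : R3) : 0 < gaussianWeight τ x := Real.exp_pos _

lemma realPartialDeriv_gaussianWeight (τ : ℝ) (i : Fin 3) (x : R3) :
    realPartialDeriv i (gaussianWeight τ) x = τ * x i * gaussianWeight τ x := by
  have h := (((hasStrictFDerivAt_norm_sq x).hasFDerivAt).const_mul (τ / 2)).exp
  rw [realPartialDeriv]
  change fderiv ℝ (fun y : R3 => Real.exp (τ / 2 * ‖y‖ ^ 2)) x _ = _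
  rw [h.fderiv]
  simp [gaussianWeight, EuclideanSpace.inner_single_right]
  ring

/-- Carleman estimate with a Gaussian weight for smooth real-valued functions. -/
lemma carleman_real {u : R3 → ℝ} {K : Set R3} (hu : ContDiff ℝ (⊤ : ℕ∞) u)
    (hK : IsCompact K) (h0 : ∀ x, x ∉ K → u x = 0) {τ : ℝ} (hτ : 0 < τ) :
    ∫ x, gaussianWeight τ x ^ 2 * (τ * (∑ i, realPartialDeriv i u x ^ 2) + 6 * τ ^ 2 * u x ^ 2)
      ≤ ∫ x, gaussianWeight τ x ^ 2 * (∑ i, realPartialDeriv i (realPartialDeriv i u) x) ^ 2 := by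
  have sw := contDiff_gaussianWeight τ
  set w := gaussianWeight τ with hw
  set v : R3 → ℝ := fun x => w x * u x with hv
  have sv : ContDiff ℝ (⊤ : ℕ∞) v := sw.mul hu
  have v0 : ∀ x, x ∉ K → v x = 0 := fun x hx => by simp [hv, h0 x hx]
  have hvx : ∀ x, v x = w x * u x := fun _ => rfl
  have dw : Differentiable ℝ w := sw.differentiable (by simp)
  have du : Differentiable ℝ u := hu.differentiable (by simp)
  have su : ∀ i, ContDiff ℝ (⊤ : ℕ∞) (realPartialDeriv i u) := contDiff_realPartialDeriv hu
  have du1 : ∀ i, Differentiable ℝ (realPartialDeriv i u) := fun i =>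
    (su i).differentiable (by simp)
  have hvc := sv.continuous
  have huc := hu.continuous
  have hwc := sw.continuous
  have cu : ∀ i, Continuous (realPartialDeriv i u) := fun i => (su i).continuous
  have cu2 : ∀ i, Continuous (realPartialDeriv i (realPartialDeriv i u)) := fun i =>
    (contDiff_realPartialDeriv (su i) i).continuous
  have cv : ∀ i, Continuous (realPartialDeriv i v) := fun i =>
    (contDiff_realPartialDeriv sv i).continuous
  have cv2 : ∀ i, Continuous (realPartialDeriv i (realPartialDeriv i v)) := fun i =>
    (contDiff_realPartialDeriv (contDiff_realPartialDeriv sv i) i).continuous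
  have uz : ∀ i x, x ∉ K → realPartialDeriv i u x = 0 := fun i x =>
    realPartialDeriv_eq_zero hK.isClosed h0 i
  have uz2 : ∀ i x, x ∉ K → realPartialDeriv i (realPartialDeriv i u) x = 0 := fun i x =>
    realPartialDeriv_eq_zero hK.isClosed (uz i) i
  have vz : ∀ i x, x ∉ K → realPartialDeriv i v x = 0 := fun i x =>
    realPartialDeriv_eq_zero hK.isClosed v0 i
  have v1 : ∀ i, realPartialDeriv i v = fun x =>
      w x * (realPartialDeriv i u x + τ * (x i * u x)) := fun i => by
    ext x
    rw [hv, realPartialDeriv_mul dw du, hw, realPartialDeriv_gaussianWeight]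
    ring
  have v2 : ∀ i x, realPartialDeriv i (realPartialDeriv i v) x = w x *
      (realPartialDeriv i (realPartialDeriv i u) x + 2 * τ * x i * realPartialDeriv i u x
        + τ ^ 2 * x i ^ 2 * u x + τ * u x) := fun i x => by
    have d1 := (differentiable_coord i).fun_mul du
    rw [v1, realPartialDeriv_mul dw ((du1 i).fun_add (d1.const_mul τ)),
      realPartialDeriv_add (du1 i) (d1.const_mul τ), realPartialDeriv_const_mul d1,
      realPartialDeriv_mul (differentiable_coord i) du, realPartialDeriv_coord, if_pos rfl, hw,
      realPartialDeriv_gaussianWeight]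
    ring
  have key := integral_symm_mul_skew sv hK v0 τ
  have key2 := integral_sum_realPartialDeriv_sq_ge sv hK v0 (τ := τ)
  have iA : Integrable (fun x => ∑ i, (realPartialDeriv i v x ^ 2 + τ ^ 2 * x i ^ 2 * v x ^ 2)) :=
    Continuous.integrable_of_eq_zero (by fun_prop) hK fun x hx => by simp [v0 x hx, vz _ x hx]
  have iV : Integrable (fun x => v x ^ 2) :=
    Continuous.integrable_of_eq_zero (by fun_prop) hK fun x hx => by simp [v0 x hx]
  have iL : Integrable (fun x => w x ^ 2 *
      (τ * (∑ i, realPartialDeriv i u x ^ 2) + 6 * τ ^ 2 * u x ^ 2)) :=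
    Continuous.integrable_of_eq_zero (by fun_prop) hK fun x hx => by simp [h0 x hx, uz _ x hx]
  have iR : Integrable (fun x => w x ^ 2 *
      (∑ i, realPartialDeriv i (realPartialDeriv i u) x) ^ 2) :=
    Continuous.integrable_of_eq_zero (by fun_prop) hK fun x hx => by simp [uz2 _ x hx]
  have iS : Integrable (fun x => 2 * (∑ i, (realPartialDeriv i (realPartialDeriv i v) x
      + τ ^ 2 * x i ^ 2 * v x)) * (-2 * τ * (∑ i, x i * realPartialDeriv i v x) - 3 * τ * v x)) :=
    Continuous.integrable_of_eq_zero (by fun_prop) hK fun x hx => by simp [v0 x hx, vz _ x hx]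
  -- The commutator supplies 4τ times the oscillator energy. Half of it pays for the gradient, since
  -- w∂ᵢu = ∂ᵢv - τxᵢv; the other half pays for 6τ²v² through the ground state bound `key2`.
  have a1 : ∫ x, w x ^ 2 * (τ * (∑ i, realPartialDeriv i u x ^ 2) + 6 * τ ^ 2 * u x ^ 2)
      ≤ ∫ x, (2 * τ * (∑ i, (realPartialDeriv i v x ^ 2 + τ ^ 2 * x i ^ 2 * v x ^ 2))
        + 6 * τ ^ 2 * v x ^ 2) := by
    refine integral_mono iL ((iA.const_mul _).add (iV.const_mul _)) fun x => ?_
    have : ∀ i, w x ^ 2 * realPartialDeriv i u x ^ 2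
        ≤ 2 * (realPartialDeriv i v x ^ 2 + τ ^ 2 * x i ^ 2 * v x ^ 2) := fun i => by
      have e : w x * realPartialDeriv i u x = realPartialDeriv i v x - τ * x i * v x := by
        rw [v1, hv]; ring
      rw [← mul_pow, e]
      nlinarith [sq_nonneg (realPartialDeriv i v x + τ * x i * v x)]
    have h3 : w x ^ 2 * ∑ i, realPartialDeriv i u x ^ 2
        ≤ 2 * ∑ i, (realPartialDeriv i v x ^ 2 + τ ^ 2 * x i ^ 2 * v x ^ 2) := by
      rw [Finset.mul_sum, Finset.mul_sum]
      exact Finset.sum_le_sum fun i _ => this i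
    have h4 : w x ^ 2 * (6 * τ ^ 2 * u x ^ 2) = 6 * τ ^ 2 * v x ^ 2 := by rw [hv]; ring
    dsimp only
    rw [mul_add, h4]
    have := mul_le_mul_of_nonneg_left h3 hτ.le
    linarith
  have a2 : ∫ x, 2 * (∑ i, (realPartialDeriv i (realPartialDeriv i v) x + τ ^ 2 * x i ^ 2 * v x))
        * (-2 * τ * (∑ i, x i * realPartialDeriv i v x) - 3 * τ * v x)
      ≤ ∫ x, w x ^ 2 * (∑ i, realPartialDeriv i (realPartialDeriv i u) x) ^ 2 := by
    refine integral_mono iS iR fun x => ?_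
    -- This is wΔu = Sv + Av, and (Sv + Av)² ≥ 2 Sv·Av pointwise.
    have e : w x * (∑ i, realPartialDeriv i (realPartialDeriv i u) x)
        = (∑ i, (realPartialDeriv i (realPartialDeriv i v) x + τ ^ 2 * x i ^ 2 * v x))
        + (-2 * τ * (∑ i, x i * realPartialDeriv i v x) - 3 * τ * v x) := by
      simp only [v2, Fin.sum_univ_three]
      rw [v1 0, v1 1, v1 2]
      simp only [hvx]
      ring
    dsimp only
    rw [← mul_pow, e]
    nlinarith [sq_nonneg (∑ i, (realPartialDeriv i (realPartialDeriv i v) x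
      + τ ^ 2 * x i ^ 2 * v x)), sq_nonneg (-2 * τ * (∑ i, x i * realPartialDeriv i v x)
      - 3 * τ * v x)]
  rw [integral_add (iA.const_mul _) (iV.const_mul _), integral_const_mul, integral_const_mul] at a1
  rw [key] at a2
  have := mul_le_mul_of_nonneg_left key2 hτ.le
  nlinarith

/-- Carleman estimate with a Gaussian weight for smooth complex-valued functions. -/
lemma carleman_complex {u : R3 → ℂ} {K : Set R3} (hu : ContDiff ℝ (⊤ : ℕ∞) u)
    (hK : IsCompact K) (h0 : ∀ x, x ∉ K → u x = 0) {τ : ℝ} (hτ : 0 < τ) :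
    ∫ x, gaussianWeight τ x ^ 2 * (τ * (∑ i, ‖partialDeriv i u x‖ ^ 2) + 6 * τ ^ 2 * ‖u x‖ ^ 2)
      ≤ ∫ x, gaussianWeight τ x ^ 2 * ‖∑ i, partialDeriv i (partialDeriv i u) x‖ ^ 2 := by
  have sre : ContDiff ℝ (⊤ : ℕ∞) (fun x => (u x).re) := Complex.reCLM.contDiff.comp hu
  have sim : ContDiff ℝ (⊤ : ℕ∞) (fun x => (u x).im) := Complex.imCLM.contDiff.comp hu
  have hre := carleman_real sre hK (fun x hx => by simp [h0 x hx]) hτ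
  have him := carleman_real sim hK (fun x hx => by simp [h0 x hx]) hτ
  have sp : ∀ i, ContDiff ℝ (⊤ : ℕ∞) (partialDeriv i u) := fun i =>
    (hu.fderiv_right (m := (⊤ : ℕ∞)) (by simp)).clm_apply contDiff_const
  have e1 : ∀ {f : R3 → ℂ} (_ : ContDiff ℝ (⊤ : ℕ∞) f) i x, (partialDeriv i f x).re
      = realPartialDeriv i (fun y => (f y).re) x := fun hf i x => by
    rw [partialDeriv_eq_re_add_im (hf.differentiable (by simp) x)]
    simp [realPartialDeriv]
  have e2 : ∀ {f : R3 → ℂ} (_ : ContDiff ℝ (⊤ : ℕ∞) f) i x, (partialDeriv i f x).im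
      = realPartialDeriv i (fun y => (f y).im) x := fun hf i x => by
    rw [partialDeriv_eq_re_add_im (hf.differentiable (by simp) x)]
    simp [realPartialDeriv]
  have f1 : ∀ i x, (partialDeriv i (partialDeriv i u) x).re
      = realPartialDeriv i (realPartialDeriv i fun y => (u y).re) x := fun i x => by
    rw [e1 (sp i)]
    simp only [e1 hu]
  have f2 : ∀ i x, (partialDeriv i (partialDeriv i u) x).im
      = realPartialDeriv i (realPartialDeriv i fun y => (u y).im) x := fun i x => by
    rw [e2 (sp i)]
    simp only [e2 hu]
  have hw := (contDiff_gaussianWeight τ).continuous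
  have hI : ∀ {f : R3 → ℝ} (_ : ContDiff ℝ (⊤ : ℕ∞) f) (_ : ∀ x, x ∉ K → f x = 0),
      Integrable (fun x => gaussianWeight τ x ^ 2 * (τ * (∑ i, realPartialDeriv i f x ^ 2)
        + 6 * τ ^ 2 * f x ^ 2)) ∧ Integrable (fun x => gaussianWeight τ x ^ 2 *
        (∑ i, realPartialDeriv i (realPartialDeriv i f) x) ^ 2) := fun {f} hf hf0 => by
    have hfc := hf.continuous
    have c1 : ∀ i, Continuous (realPartialDeriv i f) := fun i =>
      (contDiff_realPartialDeriv hf i).continuous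
    have c2 : ∀ i, Continuous (realPartialDeriv i (realPartialDeriv i f)) := fun i =>
      (contDiff_realPartialDeriv (contDiff_realPartialDeriv hf i) i).continuous
    have z1 : ∀ i x, x ∉ K → realPartialDeriv i f x = 0 := fun i x =>
      realPartialDeriv_eq_zero hK.isClosed hf0 i
    have z2 : ∀ i x, x ∉ K → realPartialDeriv i (realPartialDeriv i f) x = 0 := fun i x =>
      realPartialDeriv_eq_zero hK.isClosed (z1 i) i
    exact ⟨Continuous.integrable_of_eq_zero (by fun_prop) hK fun x hx => by
        simp [hf0 x hx, z1 _ x hx],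
      Continuous.integrable_of_eq_zero (by fun_prop) hK fun x hx => by simp [z2 _ x hx]⟩
  obtain ⟨r1, r2⟩ := hI sre (fun x hx => by simp [h0 x hx])
  obtain ⟨m1, m2⟩ := hI sim (fun x hx => by simp [h0 x hx])
  -- The weight and the constants are real, so the estimates for real and imaginary parts add up.
  have := add_le_add hre him
  rw [← integral_add r1 m1, ← integral_add r2 m2] at this
  refine (le_of_eq (integral_congr_ae (.of_forall fun x => ?_))).trans
    (this.trans (le_of_eq (integral_congr_ae (.of_forall fun x => ?_))))
  · simp only [← Complex.normSq_eq_norm_sq, Complex.normSq_apply, e1 hu, e2 hu, Fin.sum_univ_three]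
    ring
  · simp only [← Complex.normSq_eq_norm_sq, Complex.normSq_apply, Complex.re_sum, Complex.im_sum,
      f1, f2]
    ring

end SmoothCarleman

/-! ### The Carleman estimate for weak derivatives. -/

noncomputable section WeakCarleman

open Filter Topology ContinuousLinearMap
open scoped Convolution

lemma integrable_gaussianWeight_mul {f : R3 → ℂ} {R : ℝ} (hf : MemLp f 2)
    (h0 : ∀ x, R < ‖x‖ → f x = 0) (τ : ℝ) :
    Integrable (fun x => gaussianWeight τ x ^ 2 * ‖f x‖ ^ 2) := by
  have h1 : Integrable (fun x => ‖f x‖ ^ 2) := hf.integrable_norm_pow (by norm_num)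
  have hw := (contDiff_gaussianWeight τ).continuous
  rw [← integrableOn_iff_integrable_of_support_subset (s := Metric.closedBall 0 R)]
  · exact h1.integrableOn.continuousOn_mul (by fun_prop) (isCompact_closedBall 0 R)
  · intro x hx
    by_contra hxR
    simp only [Metric.mem_closedBall, dist_zero_right, not_le] at hxR
    simp [h0 x hxR] at hx

/-- Jensen's inequality for the probability density `mollifier n (x - y)`, obtained from the
nonnegativity of the variance of ‖h‖. -/
lemma sq_norm_mollify_le {h : R3 → ℂ} (hh : MemLp h 2) (n : ℕ) (x : R3) :
    ‖mollify n h x‖ ^ 2 ≤ ∫ y, mollifier n (x - y) * ‖h y‖ ^ 2 := by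
  have hl : LocallyIntegrable h := hh.locallyIntegrable (by norm_num)
  have hl2 : LocallyIntegrable (fun y => ‖h y‖ ^ 2) :=
    (hh.integrable_norm_pow (by norm_num)).locallyIntegrable
  have hcs : HasCompactSupport (fun y => mollifier n (x - y)) :=
    (hasCompactSupport_mollifier n).comp_homeomorph (Homeomorph.subLeft x)
  have hcont : Continuous (fun y => mollifier n (x - y)) :=
    (contDiff_mollifier n (k := 0)).continuous.comp (continuous_const.sub continuous_id)
  have i0 : Integrable (fun y => mollifier n (x - y)) := (integrable_mollifier n).comp_sub_left x
  have i1 : Integrable (fun y => mollifier n (x - y) * ‖h y‖) := by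
    simpa using (hh.norm.locallyIntegrable (by norm_num)).integrable_smul_left_of_hasCompactSupport hcont hcs
  have i2 : Integrable (fun y => mollifier n (x - y) * ‖h y‖ ^ 2) := by
    simpa using hl2.integrable_smul_left_of_hasCompactSupport hcont hcs
  set c := ∫ y, mollifier n (x - y) * ‖h y‖ with hc
  have e1 : ∫ y, mollifier n (x - y) = 1 := by
    rw [integral_sub_left_eq_self (fun y => mollifier n y), integral_mollifier]
  have hle : ‖mollify n h x‖ ≤ c := by
    rw [mollify_apply]
    refine norm_integral_le_of_norm_le i1 (.of_forall fun y => ?_)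
    rw [norm_smul, Real.norm_of_nonneg (mollifier_nonneg _ _)]
  have h3 : 0 ≤ ∫ y, mollifier n (x - y) * (‖h y‖ - c) ^ 2 :=
    integral_nonneg fun y => mul_nonneg (mollifier_nonneg _ _) (sq_nonneg _)
  have e2 : ∫ y, mollifier n (x - y) * (‖h y‖ - c) ^ 2
      = ∫ y, (mollifier n (x - y) * ‖h y‖ ^ 2 - 2 * c * (mollifier n (x - y) * ‖h y‖)
        + c ^ 2 * mollifier n (x - y)) :=
    integral_congr_ae (.of_forall fun y => by ring)
  have i12 : Integrable (fun y => mollifier n (x - y) * ‖h y‖ ^ 2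
      - 2 * c * (mollifier n (x - y) * ‖h y‖)) := i2.sub (i1.const_mul _)
  rw [e2, integral_add i12 (i0.const_mul _),
    integral_sub i2 (i1.const_mul _), integral_const_mul, integral_const_mul, e1, ← hc] at h3
  have := pow_le_pow_left₀ (norm_nonneg _) hle 2
  nlinarith

/-- The squared weight is exp(τ|x|²), and | |x|² - |y|² | ≤ (2|R| + 1)/(n + 1) within the kernel's
range. The exponents thus eventually differ by at most log 2. -/
lemma eventually_gaussianWeight_sq_le (τ R : ℝ) : ∀ᶠ n : ℕ in atTop, ∀ x y : R3,
    ‖y‖ ≤ R → mollifier n (x - y) ≠ 0 →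
      gaussianWeight τ x ^ 2 ≤ 2 * gaussianWeight τ y ^ 2 := by
  have ht : Tendsto (fun n : ℕ => |τ| * (2 * |R| + 1) * (1 / ((n : ℝ) + 1))) atTop (𝓝 0) := by
    simpa using tendsto_one_div_add_atTop_nhds_zero_nat.const_mul (|τ| * (2 * |R| + 1))
  filter_upwards [ht.eventually (eventually_le_nhds (Real.log_pos one_lt_two))] with n hn x y hy hxy
  have h1 : ‖x - y‖ < 1 / ((n : ℝ) + 1) := by
    by_contra hlt
    exact hxy (mollifier_eq_zero (not_lt.1 hlt))
  have hn1 : 1 / ((n : ℝ) + 1) ≤ 1 := by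
    rw [div_le_one (by positivity)]
    linarith [(n.cast_nonneg : (0 : ℝ) ≤ n)]
  have h2 : |‖x‖ - ‖y‖| ≤ 1 / ((n : ℝ) + 1) := (abs_norm_sub_norm_le x y).trans h1.le
  have h3 : |‖x‖ + ‖y‖| ≤ 2 * |R| + 1 := by
    rw [abs_of_nonneg (by positivity)]
    have := (abs_le.1 (h2.trans hn1)).2
    have := le_abs_self R
    linarith
  have h4 : τ * ‖x‖ ^ 2 - τ * ‖y‖ ^ 2 ≤ Real.log 2 := by
    calc _ = τ * ((‖x‖ + ‖y‖) * (‖x‖ - ‖y‖)) := by ring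
      _ ≤ |τ| * (|‖x‖ + ‖y‖| * |‖x‖ - ‖y‖|) := by
        rw [← abs_mul, ← abs_mul]; exact le_abs_self _
      _ ≤ |τ| * ((2 * |R| + 1) * (1 / ((n : ℝ) + 1))) := by gcongr
      _ ≤ Real.log 2 := by rw [← mul_assoc]; exact hn
  have e : ∀ z : R3, gaussianWeight τ z ^ 2 = Real.exp (τ * ‖z‖ ^ 2) := fun z => by
    rw [gaussianWeight, ← Real.exp_nat_mul]
    congr 1
    push_cast
    ring
  rw [e, e]
  calc Real.exp (τ * ‖x‖ ^ 2) ≤ Real.exp (Real.log 2 + τ * ‖y‖ ^ 2) :=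
        Real.exp_le_exp.2 (by linarith)
    _ = _ := by rw [Real.exp_add, Real.exp_log zero_lt_two]

/-- By Jensen and the slow variation of the weight, the left integrand is at most twice the
convolution of the kernel with the weighted ‖h‖², and convolution with a kernel of mass one
preserves the integral. -/
lemma eventually_integral_gaussianWeight_mollify_le {h : R3 → ℂ} {R : ℝ} (hh : MemLp h 2)
    (h0 : ∀ x, R < ‖x‖ → h x = 0) (τ : ℝ) : ∀ᶠ n : ℕ in atTop,
    ∫ x, gaussianWeight τ x ^ 2 * ‖mollify n h x‖ ^ 2
      ≤ 2 * ∫ x, gaussianWeight τ x ^ 2 * ‖h x‖ ^ 2 := by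
  have hH := integrable_gaussianWeight_mul hh h0 τ
  set H : R3 → ℝ := fun x => gaussianWeight τ x ^ 2 * ‖h x‖ ^ 2 with hHdef
  filter_upwards [eventually_gaussianWeight_sq_le τ R] with n hn
  have hconv := integral_convolution (lsmul ℝ ℝ : ℝ →L[ℝ] ℝ →L[ℝ] ℝ) (μ := volume) (ν := volume)
    (integrable_mollifier n) hH
  have hint := (integrable_mollifier n).integrable_convolution
    (lsmul ℝ ℝ : ℝ →L[ℝ] ℝ →L[ℝ] ℝ) (μ := volume) hH
  rw [integral_mollifier, lsmul_apply, one_smul] at hconv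
  rw [← hconv, ← integral_const_mul]
  refine integral_mono_of_nonneg (.of_forall fun x => by positivity) (hint.const_mul 2)
    (.of_forall fun x => ?_)
  dsimp only
  rw [convolution_eq_swap]
  simp only [lsmul_apply, smul_eq_mul]
  have hl2 : LocallyIntegrable (fun y => ‖h y‖ ^ 2) :=
    (hh.integrable_norm_pow (by norm_num)).locallyIntegrable
  have hcs : HasCompactSupport (fun y => mollifier n (x - y)) :=
    (hasCompactSupport_mollifier n).comp_homeomorph (Homeomorph.subLeft x)
  have hcont : Continuous (fun y => mollifier n (x - y)) :=
    (contDiff_mollifier n (k := 0)).continuous.comp (continuous_const.sub continuous_id)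
  have i3 : Integrable (fun y => mollifier n (x - y) * H y) := by
    simpa using hH.locallyIntegrable.integrable_smul_left_of_hasCompactSupport hcont hcs
  refine (mul_le_mul_of_nonneg_left (sq_norm_mollify_le hh n x) (sq_nonneg _)).trans ?_
  rw [← integral_const_mul, ← integral_const_mul]
  refine integral_mono_of_nonneg (.of_forall fun y => ?_) (i3.const_mul 2) (.of_forall fun y => ?_)
  · exact mul_nonneg (sq_nonneg _) (mul_nonneg (mollifier_nonneg _ _) (sq_nonneg _))
  · dsimp only
    by_cases hy : R < ‖y‖
    · simp [hHdef, h0 y hy]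
    by_cases hm : mollifier n (x - y) = 0
    · simp [hm]
    have := hn x y (not_lt.1 hy) hm
    have h5 := mul_le_mul_of_nonneg_right this
      (mul_nonneg (mollifier_nonneg n (x - y)) (sq_nonneg ‖h y‖))
    simp only [hHdef]
    linarith

/-- Carleman estimate with a Gaussian weight for compactly supported weak solutions of
`-Δ u = h` with `h` square integrable. -/
lemma carleman_weak {u h : R3 → ℂ} {U : Fin 3 → R3 → ℂ} {R : ℝ}
    (hu0 : ∀ x, R < ‖x‖ → u x = 0) (hh0 : ∀ x, R < ‖x‖ → h x = 0)
    (hu : ∀ i, HasWeakDeriv i u (U i)) (hh : MemLp h 2)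
    (hdiv : ∀ φ, IsTestFunction φ → ∫ x, ∑ i, U i x * partialDeriv i φ x = ∫ x, h x * φ x)
    {τ : ℝ} (hτ : 0 < τ) :
    ∫ x, gaussianWeight τ x ^ 2 * (τ * (∑ i, ‖U i x‖ ^ 2) + 6 * τ ^ 2 * ‖u x‖ ^ 2)
      ≤ 2 * ∫ x, gaussianWeight τ x ^ 2 * ‖h x‖ ^ 2 := by
  have hul : LocallyIntegrable u := (hu 0).1
  have hUl : ∀ i, LocallyIntegrable (U i) := fun i => (hu i).2.1
  have hw := (contDiff_gaussianWeight τ).continuous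
  set B := 2 * ∫ x, gaussianWeight τ x ^ 2 * ‖h x‖ ^ 2 with hB
  have hB0 : 0 ≤ B := mul_nonneg zero_le_two (integral_nonneg fun x => by positivity)
  set G : ℕ → R3 → ℝ := fun n x => gaussianWeight τ x ^ 2 *
    (τ * (∑ i, ‖mollify n (U i) x‖ ^ 2) + 6 * τ ^ 2 * ‖mollify n u x‖ ^ 2) with hG
  set G' : R3 → ℝ := fun x => gaussianWeight τ x ^ 2 *
    (τ * (∑ i, ‖U i x‖ ^ 2) + 6 * τ ^ 2 * ‖u x‖ ^ 2) with hG'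
  have G0 : ∀ n x, 0 ≤ G n x := fun n x => by positivity
  have G'0 : ∀ x, 0 ≤ G' x := fun x => by positivity
  have hUc : ∀ n i, Continuous (mollify n (U i)) := fun n i => (contDiff_mollify (hUl i) n).continuous
  have huc : ∀ n, Continuous (mollify n u) := fun n => (contDiff_mollify hul n).continuous
  have hGc : ∀ n, Continuous (G n) := fun n => by
    have := hUc n
    have := huc n
    fun_prop
  have mz : ∀ n x, x ∉ Metric.closedBall (0 : R3) (R + 1) → mollify n u x = 0 := fun n x hx =>
    mollify_eq_zero hu0 n (by simpa using hx)
  have hpz : ∀ n i x, x ∉ Metric.closedBall (0 : R3) (R + 1) → mollify n (U i) x = 0 :=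
    fun n i x hx => by
      rw [← partialDeriv_mollify (hu i)]
      have : mollify n u =ᶠ[nhds x] fun _ => 0 := by
        filter_upwards [Metric.isClosed_closedBall.isOpen_compl.mem_nhds hx] with y hy
          using mz n y hy
      rw [partialDeriv, this.fderiv_eq]
      simp
  have hGi : ∀ n, Integrable (G n) := fun n =>
    (hGc n).integrable_of_eq_zero (isCompact_closedBall (0 : R3) (R + 1)) fun x hx => by
      simp [hG, mz n x hx, hpz n _ x hx]
  have hle : ∀ᶠ n in atTop, ∫ x, G n x ≤ B := by
    filter_upwards [eventually_integral_gaussianWeight_mollify_le hh hh0 τ] with n hn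
    have := carleman_complex (contDiff_mollify hul n) (isCompact_closedBall (0 : R3) (R + 1))
      (mz n) hτ
    simp only [partialDeriv_mollify (hu _), sum_partialDeriv_mollify hUl hdiv, norm_neg] at this
    exact this.trans hn
  have htend : ∀ᵐ x, Tendsto (fun n => G n x) atTop (𝓝 (G' x)) := by
    filter_upwards [ae_tendsto_mollify hul, ae_all_iff.2 fun i => ae_tendsto_mollify (hUl i)]
      with x h1 h2
    exact (((tendsto_finsetSum _ fun i _ => (h2 i).norm.pow 2).const_mul _).add
      ((h1.norm.pow 2).const_mul _)).const_mul _
  -- Fatou's lemma: a bound along the mollifications and almost everywhere convergence suffice, so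
  -- no convergence in L² is needed.
  have hlin : ∫⁻ x, ENNReal.ofReal (G' x) ≤ ENNReal.ofReal B := by
    calc ∫⁻ x, ENNReal.ofReal (G' x)
        = ∫⁻ x, liminf (fun n => ENNReal.ofReal (G n x)) atTop := by
          refine lintegral_congr_ae ?_
          filter_upwards [htend] with x hx
          exact (ENNReal.tendsto_ofReal hx).liminf_eq.symm
      _ ≤ liminf (fun n => ∫⁻ x, ENNReal.ofReal (G n x)) atTop :=
          lintegral_liminf_le fun n => (hGc n).measurable.ennreal_ofReal
      _ ≤ ENNReal.ofReal B := by
          refine liminf_le_of_frequently_le' (Eventually.frequently ?_)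
          filter_upwards [hle] with n hn
          rw [← ofReal_integral_eq_lintegral_ofReal (hGi n) (.of_forall (G0 n))]
          exact ENNReal.ofReal_le_ofReal hn
  have hm : AEStronglyMeasurable G' := by
    have a1 := hul.aestronglyMeasurable
    have a2 := fun i => (hUl i).aestronglyMeasurable
    refine (hw.pow 2).aestronglyMeasurable.mul (((Finset.aestronglyMeasurable_fun_sum _ fun i _ =>
      (a2 i).norm.pow 2).const_mul _).add ((a1.norm.pow 2).const_mul _))
  rw [integral_eq_lintegral_of_nonneg_ae (.of_forall G'0) hm]
  exact (ENNReal.toReal_mono ENNReal.ofReal_ne_top hlin).trans (ENNReal.toReal_ofReal hB0).le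

/-! ### Absorption of coupled lower order terms. -/

/-- The square of the norm in `L²` with a Gaussian weight. -/
def weightedSq (τ : ℝ) (f : R3 → ℂ) : ℝ := ∫ x, gaussianWeight τ x ^ 2 * ‖f x‖ ^ 2

lemma weightedSq_nonneg (τ : ℝ) (f : R3 → ℂ) : 0 ≤ weightedSq τ f :=
  integral_nonneg fun x => by positivity

lemma ae_eq_zero_of_weightedSq {τ : ℝ} {f : R3 → ℂ} {R : ℝ} (hf : MemLp f 2)
    (h0 : ∀ x, R < ‖x‖ → f x = 0) (h : weightedSq τ f = 0) : f =ᵐ[volume] 0 := by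
  rw [weightedSq, integral_eq_zero_iff_of_nonneg (fun x => by positivity)
    (integrable_gaussianWeight_mul hf h0 τ)] at h
  filter_upwards [h] with x hx
  simpa [(gaussianWeight_pos τ x).ne'] using hx

/-- A compactly supported square integrable function with square integrable support-preserving
first derivatives and Laplacian, recorded through representatives vanishing outside a ball. -/
structure IsLaplacianPair (R : ℝ) (u h : R3 → ℂ) (U : Fin 3 → R3 → ℂ) : Prop where
  zero_u : ∀ x, R < ‖x‖ → u x = 0
  zero_U : ∀ i x, R < ‖x‖ → U i x = 0
  zero_h : ∀ x, R < ‖x‖ → h x = 0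
  memLp_u : MemLp u 2
  memLp_U : ∀ i, MemLp (U i) 2
  memLp_h : MemLp h 2
  weakDeriv : ∀ i, HasWeakDeriv i u (U i)
  weakLaplacian : ∀ φ, IsTestFunction φ →
    ∫ x, ∑ i, U i x * partialDeriv i φ x = ∫ x, h x * φ x

lemma IsLaplacianPair.carleman {R : ℝ} {u h : R3 → ℂ} {U : Fin 3 → R3 → ℂ}
    (H : IsLaplacianPair R u h U) {τ : ℝ} (hτ : 0 < τ) :
    τ * (∑ i, weightedSq τ (U i)) + 6 * τ ^ 2 * weightedSq τ u ≤ 2 * weightedSq τ h := by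
  have c := carleman_weak H.zero_u H.zero_h H.weakDeriv H.memLp_h H.weakLaplacian hτ
  have iu := integrable_gaussianWeight_mul H.memLp_u H.zero_u τ
  have iU := fun i => integrable_gaussianWeight_mul (H.memLp_U i) (H.zero_U i) τ
  refine le_trans (le_of_eq ?_) c
  simp only [weightedSq]
  rw [← integral_finsetSum _ fun i _ => iU i, ← integral_const_mul, ← integral_const_mul,
    ← integral_add ((integrable_finsetSum _ fun i _ => iU i).const_mul _) (iu.const_mul _)]
  refine integral_congr_ae (.of_forall fun x => ?_)
  simp only [← Finset.mul_sum]
  ring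

lemma IsLaplacianPair.weightedSq_le {R : ℝ} {u v h k : R3 → ℂ} {U V : Fin 3 → R3 → ℂ}
    (H : IsLaplacianPair R u h U) (H' : IsLaplacianPair R v k V) {M : ℝ}
    (hb : ∀ᵐ x, ‖h x‖ ^ 2 ≤ M * ((∑ i, ‖U i x‖ ^ 2) + ‖u x‖ ^ 2 + ‖v x‖ ^ 2)) (τ : ℝ) :
    weightedSq τ h ≤ M * ((∑ i, weightedSq τ (U i)) + weightedSq τ u + weightedSq τ v) := by
  have iu := integrable_gaussianWeight_mul H.memLp_u H.zero_u τ
  have iv := integrable_gaussianWeight_mul H'.memLp_u H'.zero_u τ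
  have ih := integrable_gaussianWeight_mul H.memLp_h H.zero_h τ
  have iU : ∀ i, _ := fun i => integrable_gaussianWeight_mul (H.memLp_U i) (H.zero_U i) τ
  have iS := integrable_finsetSum Finset.univ fun i _ => iU i
  have iSu : Integrable (fun x => (∑ i, gaussianWeight τ x ^ 2 * ‖U i x‖ ^ 2)
    + gaussianWeight τ x ^ 2 * ‖u x‖ ^ 2) := iS.add iu
  have iSuv : Integrable (fun x => (∑ i, gaussianWeight τ x ^ 2 * ‖U i x‖ ^ 2)
    + gaussianWeight τ x ^ 2 * ‖u x‖ ^ 2 + gaussianWeight τ x ^ 2 * ‖v x‖ ^ 2) := iSu.add iv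
  simp only [weightedSq]
  rw [← integral_finsetSum _ fun i _ => iU i, ← integral_add iS iu, ← integral_add iSu iv,
    ← integral_const_mul]
  refine integral_mono_ae ih (iSuv.const_mul M) ?_
  filter_upwards [hb] with x hx
  have := mul_le_mul_of_nonneg_left hx (sq_nonneg (gaussianWeight τ x))
  rw [← Finset.mul_sum]
  linarith

/-- A compactly supported solution of a coupled system of differential inequalities
`|Δ u| ≤ C (|∇ u| + |u| + |v|)`, `|Δ v| ≤ C (|∇ v| + |v| + |u|)` vanishes. -/
lemma IsLaplacianPair.eq_zero_of_coupled_inequality {R : ℝ} {u v h k : R3 → ℂ}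
    {U V : Fin 3 → R3 → ℂ} (H : IsLaplacianPair R u h U) (H' : IsLaplacianPair R v k V) {M : ℝ}
    (hM : 0 ≤ M)
    (hb : ∀ᵐ x, ‖h x‖ ^ 2 ≤ M * ((∑ i, ‖U i x‖ ^ 2) + ‖u x‖ ^ 2 + ‖v x‖ ^ 2))
    (kb : ∀ᵐ x, ‖k x‖ ^ 2 ≤ M * ((∑ i, ‖V i x‖ ^ 2) + ‖v x‖ ^ 2 + ‖u x‖ ^ 2)) :
    u =ᵐ[volume] 0 ∧ v =ᵐ[volume] 0 := by
  -- In the sum of both estimates the right side carries 2M on the gradients and 4M on `u` and `v`,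
  -- each of which enters both inequalities. This choice gives 2M ≤ τ and 4M + 1 ≤ 6τ².
  obtain ⟨τ, hτ⟩ : ∃ τ : ℝ, τ = 2 * M + 1 := ⟨_, rfl⟩
  have hτ0 : 0 < τ := by rw [hτ]; positivity
  have c1 := H.carleman hτ0
  have c2 := H'.carleman hτ0
  have b1 := H.weightedSq_le H' hb τ
  have b2 := H'.weightedSq_le H kb τ
  have pU : 0 ≤ ∑ i, weightedSq τ (U i) := Finset.sum_nonneg fun i _ => weightedSq_nonneg _ _
  have pV : 0 ≤ ∑ i, weightedSq τ (V i) := Finset.sum_nonneg fun i _ => weightedSq_nonneg _ _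
  have pu := weightedSq_nonneg τ u
  have pv := weightedSq_nonneg τ v
  have hz : weightedSq τ u + weightedSq τ v ≤ 0 := by
    have t1 : 2 * M * ((∑ i, weightedSq τ (U i)) + ∑ i, weightedSq τ (V i))
        ≤ τ * ((∑ i, weightedSq τ (U i)) + ∑ i, weightedSq τ (V i)) :=
      mul_le_mul_of_nonneg_right (by linarith) (by linarith)
    have t2 : (4 * M + 1) * (weightedSq τ u + weightedSq τ v)
        ≤ 6 * τ ^ 2 * (weightedSq τ u + weightedSq τ v) :=
      mul_le_mul_of_nonneg_right (by rw [hτ]; nlinarith) (by linarith)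
    linarith
  exact ⟨ae_eq_zero_of_weightedSq H.memLp_u H.zero_u (le_antisymm (by linarith) pu),
    ae_eq_zero_of_weightedSq H'.memLp_u H'.zero_u (le_antisymm (by linarith) pv)⟩

end WeakCarleman

/-! ### From the weak equations to functions with square integrable Laplacian. -/

noncomputable section WeakSolutions

open Filter Topology
open scoped LineDeriv SchwartzMap

/-- One derivative lowers the Sobolev order from 1 to 0, which is L²; test functions are Schwartz
functions, so the distributional identity becomes the weak one. -/
lemma MemH1.exists_hasWeakDeriv {f : Lp ℂ 2 (volume : Measure R3)} (hf : MemH1 f) (i : Fin 3) :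
    ∃ U : R3 → ℂ, MemLp U 2 ∧ HasWeakDeriv i f U := by
  have h := TemperedDistribution.MemSobolev.lineDerivOp hf (m := EuclideanSpace.single i 1)
  rw [sub_self, TemperedDistribution.memSobolev_zero_iff] at h
  obtain ⟨U, hU⟩ := h
  refine ⟨U, Lp.memLp U, (Lp.memLp f).locallyIntegrable (by norm_num),
    (Lp.memLp U).locallyIntegrable (by norm_num), fun φ hφ => ?_⟩
  have hs := congrArg (fun T => T (hφ.2.toSchwartzMap hφ.1)) hU
  simp only [TemperedDistribution.lineDerivOp_apply_apply, Lp.toTemperedDistribution_apply,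
    smul_eq_mul] at hs
  rw [← neg_eq_iff_eq_neg, ← integral_neg]
  refine Eq.trans (integral_congr_ae (.of_forall fun x => ?_))
    (hs.trans (integral_congr_ae (.of_forall fun x => ?_)))
  · simp only [neg_apply, SchwartzMap.lineDerivOp_apply_eq_fderiv, partialDeriv]
    rw [neg_mul, mul_comm]
    rfl
  · exact mul_comm _ _

lemma HasWeakDeriv.weakDeriv_ae_eq {i : Fin 3} {u U : R3 → ℂ} (h : HasWeakDeriv i u U) :
    weakDeriv i u =ᵐ[volume] U := by
  have hex : ∃ U, HasWeakDeriv i u U := ⟨U, h⟩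
  rw [weakDeriv, dif_pos hex]
  exact hex.choose_spec.ae_eq h

lemma HasWeakDeriv.congr_ae {i : Fin 3} {u u' U U' : R3 → ℂ} (h : HasWeakDeriv i u U)
    (hu : u =ᵐ[volume] u') (hU : U =ᵐ[volume] U') : HasWeakDeriv i u' U' := by
  refine ⟨h.1.congr hu, h.2.1.congr hU, fun φ hφ => ?_⟩
  have e1 : ∫ x, u' x * partialDeriv i φ x = ∫ x, u x * partialDeriv i φ x :=
    integral_congr_ae (by filter_upwards [hu] with x hx; rw [hx])
  have e2 : ∫ x, U' x * φ x = ∫ x, U x * φ x :=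
    integral_congr_ae (by filter_upwards [hU] with x hx; rw [hx])
  rw [e1, e2, h.2.2 φ hφ]

/-- Weak differentiation does not enlarge the support. -/
lemma HasWeakDeriv.ae_eq_zero_of_lt_norm {i : Fin 3} {u U : R3 → ℂ} (h : HasWeakDeriv i u U)
    {R : ℝ} (hu : ∀ᵐ x, R < ‖x‖ → u x = 0) : ∀ᵐ x, R < ‖x‖ → U x = 0 := by
  have ho : IsOpen {x : R3 | R < ‖x‖} := isOpen_lt continuous_const continuous_norm
  refine ho.ae_eq_zero_of_integral_contDiff_smul_eq_zero (h.2.1.locallyIntegrableOn _)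
    fun φ hφ hc hsub => ?_
  have ht : IsTestFunction (fun x => (φ x : ℂ)) :=
    ⟨Complex.ofRealCLM.contDiff.comp hφ, hc.comp_left Complex.ofReal_zero⟩
  have e := h.2.2 _ ht
  have z : ∫ x, u x * partialDeriv i (fun x => (φ x : ℂ)) x = 0 := by
    refine integral_eq_zero_of_ae ?_
    filter_upwards [hu] with x hx
    by_cases hxR : R < ‖x‖
    · simp [hx hxR]
    · have hn : x ∉ tsupport φ := fun hmem => hxR (hsub hmem)
      have : (fun x => (φ x : ℂ)) =ᶠ[𝓝 x] fun _ => 0 := by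
        filter_upwards [(isClosed_tsupport φ).isOpen_compl.mem_nhds hn] with y hy
        rw [image_eq_zero_of_notMem_tsupport hy, Complex.ofReal_zero]
      simp [partialDeriv, this.fderiv_eq]
  rw [z, eq_comm, neg_eq_zero] at e
  rw [← e]
  exact integral_congr_ae (.of_forall fun x => by simp [mul_comm])

lemma lipschitzWith_inv {s : R3 → ℂ} {K : NNReal} (hs : LipschitzWith K s) {c : NNReal}
    (hc : 0 < c) (hcs : ∀ x, c ≤ ‖s x‖) : LipschitzWith (K / c ^ 2) (fun x => (s x)⁻¹) := by
  refine LipschitzWith.of_dist_le_mul fun x y => ?_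
  have hc' : (0 : ℝ) < c := hc
  have hx : s x ≠ 0 := norm_pos_iff.1 (hc'.trans_le (hcs x))
  have hy : s y ≠ 0 := norm_pos_iff.1 (hc'.trans_le (hcs y))
  have h := hs.dist_le_mul x y
  rw [dist_inv_inv₀ hx hy]
  push_cast
  rw [div_mul_eq_mul_div, sq]
  have := hcs x
  have := hcs y
  gcongr

/-- Division by `s` turns a weak solution of `-Δ u + (Δ s / s) u + p u + q v = 0` into a function
with square integrable Laplacian, bounded by lower order terms. -/
lemma IsWeakSolution.exists_isLaplacianPair {s p q u v : R3 → ℂ} {K c : NNReal}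
    (hs : LipschitzWith K s) (hc : 0 < c) (hcs : ∀ x, c ≤ ‖s x‖) {C : ℝ}
    (hp : AEStronglyMeasurable p) (hq : AEStronglyMeasurable q)
    (hpC : ∀ x, ‖p x‖ ≤ C) (hqC : ∀ x, ‖q x‖ ≤ C) {R : ℝ}
    (hu : MemLp u 2) (hv : MemLp v 2) (hu0 : ∀ᵐ x, R < ‖x‖ → u x = 0)
    (hv0 : ∀ᵐ x, R < ‖x‖ → v x = 0) (hU : ∀ i, ∃ U : R3 → ℂ, MemLp U 2 ∧ HasWeakDeriv i u U)
    (hsol : IsWeakSolution s p q u v) :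
    ∃ F h W M, IsLaplacianPair R F h W ∧ (∀ᵐ x, u x = s x * F x) ∧ 0 ≤ M ∧
      ∀ᵐ x, ‖h x‖ ^ 2 ≤ M * ((∑ i, ‖W i x‖ ^ 2) + ‖F x‖ ^ 2 + ‖v x‖ ^ 2) := by
  choose U mU dU using hU
  have hc' : (0 : ℝ) < c := hc
  have hC : 0 ≤ C := (norm_nonneg _).trans (hpC 0)
  have hs0 : ∀ x, s x ≠ 0 := fun x => norm_pos_iff.1 (hc'.trans_le (hcs x))
  set r : R3 → ℂ := fun x => (s x)⁻¹ with hr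
  set K' := K / c ^ 2 with hK'
  have lr : LipschitzWith K' r := lipschitzWith_inv hs hc hcs
  have br : ∀ x, ‖r x‖ ≤ (c : ℝ)⁻¹ := fun x => by
    rw [hr, norm_inv]; exact inv_anti₀ hc' (hcs x)
  set F : R3 → ℂ := fun x => r x * u x with hF
  set W : Fin 3 → R3 → ℂ := fun i x => r x * U i x + partialDeriv i r x * u x with hW
  have dF : ∀ i, HasWeakDeriv i F (W i) := fun i => (dU i).lipschitz_mul lr
  have mF : MemLp F 2 := hu.of_le_mul (lr.continuous.aestronglyMeasurable.mul hu.1)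
    (.of_forall fun x => by rw [norm_mul]; exact mul_le_mul_of_nonneg_right (br x) (norm_nonneg _))
  have mW : ∀ i, MemLp (W i) 2 := fun i =>
    MemLp.add ((mU i).of_le_mul (lr.continuous.aestronglyMeasurable.mul (mU i).1)
    (.of_forall fun x => by rw [norm_mul]; exact mul_le_mul_of_nonneg_right (br x) (norm_nonneg _)))
    (hu.of_le_mul ((measurable_partialDeriv r i).aestronglyMeasurable.mul hu.1)
    (.of_forall fun x => by
      rw [norm_mul]
      exact mul_le_mul_of_nonneg_right (norm_partialDeriv_le lr i x) (norm_nonneg _)))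
  have usF : ∀ x, u x = s x * F x := fun x => by
    rw [hF, hr]; field_simp [hs0 x]
  have F0 : ∀ᵐ x, R < ‖x‖ → F x = 0 := by
    filter_upwards [hu0] with x hx hxR
    simp [hF, hx hxR]
  have W0 : ∀ᵐ x, ∀ i, R < ‖x‖ → W i x = 0 := ae_all_iff.2 fun i => (dF i).ae_eq_zero_of_lt_norm F0
  have lF : LocallyIntegrable F := (dF 0).1
  have lW : ∀ i, LocallyIntegrable (W i) := fun i => (dF i).2.1
  have lu : LocallyIntegrable u := hu.locallyIntegrable (by norm_num)
  have lv : LocallyIntegrable v := hv.locallyIntegrable (by norm_num)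
  have l1 : ∀ i, LocallyIntegrable (fun x => s x * W i x) := fun i =>
    locallyIntegrable_continuous_mul (lW i) hs.continuous
  have l2 : ∀ i, LocallyIntegrable (fun x => partialDeriv i s x * F x) := fun i =>
    locallyIntegrable_mul_of_bound lF (measurable_partialDeriv s i).aestronglyMeasurable
      (norm_partialDeriv_le hs i)
  have l3 : ∀ i, LocallyIntegrable (fun x => partialDeriv i s x * W i x) := fun i =>
    locallyIntegrable_mul_of_bound (lW i) (measurable_partialDeriv s i).aestronglyMeasurable
      (norm_partialDeriv_le hs i)
  have l3' : LocallyIntegrable (fun x => ∑ i, partialDeriv i s x * W i x) := by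
    simp only [Fin.sum_univ_three]
    exact ((l3 0).add (l3 1)).add (l3 2)
  have l4 : LocallyIntegrable (fun x => p x * u x + q x * v x) :=
    (locallyIntegrable_mul_of_bound lu hp hpC).add (locallyIntegrable_mul_of_bound lv hq hqC)
  -- Here `W` is ∇F with F = u/s, and the equation is read as -div(s∇F) = `h1`.
  set h1 : R3 → ℂ := fun x => (∑ i, partialDeriv i s x * W i x) - (p x * u x + q x * v x) with hh1
  have lh1 : LocallyIntegrable h1 := l3'.sub l4
  have div1 : ∀ φ, IsTestFunction φ →
      ∫ x, ∑ i, (s x * W i x) * partialDeriv i φ x = ∫ x, h1 x * φ x := fun φ hφ => by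
    have cφ : ∀ i, Continuous (partialDeriv i φ) := hφ.continuous_partialDeriv
    have sφ : ∀ i, HasCompactSupport (partialDeriv i φ) := hφ.hasCompactSupport_partialDeriv
    obtain ⟨D, hD⟩ := (contDiff_infty.1 hφ.1 1).lipschitzWith_of_hasCompactSupport hφ.2 one_ne_zero
    have e := hsol φ hφ
    have i1 : Integrable (fun x => ∑ i, (s x * W i x) * partialDeriv i φ x) :=
      integrable_finsetSum _ fun i _ => (l1 i).integrable_mul_hasCompactSupport (cφ i) (sφ i)
    have i2 : Integrable (fun x => ∑ i, (partialDeriv i s x * F x) * partialDeriv i φ x) :=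
      integrable_finsetSum _ fun i _ => (l2 i).integrable_mul_hasCompactSupport (cφ i) (sφ i)
    have i3 : Integrable (fun x => (∑ i, partialDeriv i s x * W i x) * φ x) :=
      l3'.integrable_mul_hasCompactSupport hφ.continuous hφ.2
    have i4 : Integrable (fun x => (p x * u x + q x * v x) * φ x) :=
      l4.integrable_mul_hasCompactSupport hφ.continuous hφ.2
    have e1 : ∫ x, ∑ i, weakDeriv i u x * partialDeriv i φ x
        = (∫ x, ∑ i, (s x * W i x) * partialDeriv i φ x)
          + ∫ x, ∑ i, (partialDeriv i s x * F x) * partialDeriv i φ x := by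
      rw [← integral_add i1 i2]
      have : ∀ᵐ x, ∀ i, weakDeriv i u x = s x * W i x + partialDeriv i s x * F x := by
        rw [ae_all_iff]
        intro i
        have hd := (dF i).lipschitz_mul hs
        rw [← funext usF] at hd
        exact hd.weakDeriv_ae_eq
      refine integral_congr_ae ?_
      filter_upwards [this] with x hx
      rw [← Finset.sum_add_distrib]
      exact Finset.sum_congr rfl fun i _ => by rw [hx i]; ring
    -- As uφ/s = Fφ, the potential contributes -F∇s·∇φ - φ∇s·∇F; its first term cancels the F∇s·∇φ
    -- coming from ∇u = s∇F + F∇s.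
    have e2 : weakPotential s u φ
        = -((∫ x, ∑ i, (partialDeriv i s x * F x) * partialDeriv i φ x)
          + ∫ x, (∑ i, partialDeriv i s x * W i x) * φ x) := by
      rw [← integral_add i2 i3, ← integral_neg, weakPotential]
      have a1 : ∀ᵐ x, ∀ i, weakDeriv i s x = partialDeriv i s x :=
        ae_all_iff.2 fun i => (hs.hasWeakDeriv i).weakDeriv_ae_eq
      have a2 : ∀ᵐ x, ∀ i, weakDeriv i (fun y => u y * φ y / s y) x
          = φ x * W i x + partialDeriv i φ x * F x := by
        rw [ae_all_iff]
        intro i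
        have hd := (dF i).lipschitz_mul hD
        have : (fun x => φ x * F x) = fun y => u y * φ y / s y := by
          ext y
          rw [hF, hr]
          field_simp
        rw [this] at hd
        exact hd.weakDeriv_ae_eq
      refine integral_congr_ae ?_
      filter_upwards [a1, a2] with x h1 h2
      rw [Finset.sum_mul, ← Finset.sum_add_distrib]
      congr 1
      exact Finset.sum_congr rfl fun i _ => by rw [h1 i, h2 i]; ring
    have e3 : ∫ x, h1 x * φ x = (∫ x, (∑ i, partialDeriv i s x * W i x) * φ x)
        - ∫ x, (p x * u x + q x * v x) * φ x := by
      rw [← integral_sub i3 i4]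
      exact integral_congr_ae (.of_forall fun x => by simp only [hh1]; ring)
    rw [e1, e2] at e
    rw [e3]
    linear_combination e
  -- Multiplying the field s∇F by the Lipschitz function 1/s isolates the Laplacian: -ΔF = `h2`.
  set h2 : R3 → ℂ := fun x => r x * h1 x - ∑ i, (s x * W i x) * partialDeriv i r x with hh2
  have div2 : ∀ φ, IsTestFunction φ → ∫ x, ∑ i, W i x * partialDeriv i φ x = ∫ x, h2 x * φ x :=
    fun φ hφ => by
      rw [← integral_sum_lipschitz_mul l1 lh1 div1 lr hφ]
      refine integral_congr_ae (.of_forall fun x => Finset.sum_congr rfl fun i _ => ?_)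
      have : r x * (s x * W i x) = W i x := by
        rw [← mul_assoc, hr, inv_mul_cancel₀ (hs0 x), one_mul]
      rw [this]
  set B : Set R3 := Metric.closedBall 0 R with hB
  have mB : MeasurableSet B := Metric.isClosed_closedBall.measurableSet
  -- `IsLaplacianPair` asks for vanishing at every point outside the ball, so the functions are
  -- replaced by their cutoffs to `B`, which agree with them almost everywhere.
  have memB : ∀ {x : R3}, x ∉ B ↔ R < ‖x‖ := fun {x} => by simp [hB]
  have ind : ∀ {f : R3 → ℂ}, (∀ᵐ x, R < ‖x‖ → f x = 0) → f =ᵐ[volume] B.indicator f := by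
    intro f hf
    filter_upwards [hf] with x hx
    by_cases hxB : x ∈ B
    · rw [indicator_of_mem hxB]
    · rw [indicator_of_notMem hxB, hx (memB.1 hxB)]
  have W0' : ∀ i, ∀ᵐ x, R < ‖x‖ → W i x = 0 := ae_all_iff.1 W0
  have h20 : ∀ᵐ x, R < ‖x‖ → h2 x = 0 := by
    filter_upwards [hu0, hv0, W0] with x a1 a2 a3 hx
    simp [hh2, hh1, a1 hx, a2 hx, a3 _ hx]
  obtain ⟨S, hS⟩ := (isCompact_closedBall (0 : R3) R).exists_bound_of_continuousOn
    hs.continuous.continuousOn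
  obtain ⟨D, hDdef⟩ : ∃ D : ℝ, D = (c : ℝ)⁻¹ * (K + C * |S| + C) + |S| * K' := ⟨_, rfl⟩
  have hD0 : 0 ≤ D := by rw [hDdef]; positivity
  have bound : ∀ x ∈ B, ‖h2 x‖ ≤ D * ((∑ i, ‖W i x‖) + ‖F x‖ + ‖v x‖) := by
    intro x hx
    have hSx : ‖s x‖ ≤ |S| := (hS x hx).trans (le_abs_self S)
    have b1 : ‖∑ i, partialDeriv i s x * W i x‖ ≤ K * ∑ i, ‖W i x‖ := by
      rw [Finset.mul_sum]
      refine norm_sum_le_of_le _ fun i _ => ?_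
      rw [norm_mul]
      exact mul_le_mul_of_nonneg_right (norm_partialDeriv_le hs i x) (norm_nonneg _)
    have b2 : ‖∑ i, (s x * W i x) * partialDeriv i r x‖ ≤ |S| * K' * ∑ i, ‖W i x‖ := by
      rw [Finset.mul_sum]
      refine norm_sum_le_of_le _ fun i _ => ?_
      rw [norm_mul, norm_mul, mul_right_comm]
      exact mul_le_mul_of_nonneg_right (mul_le_mul hSx (norm_partialDeriv_le lr i x)
        (norm_nonneg _) (abs_nonneg _)) (norm_nonneg _)
    have b3 : ‖p x * u x + q x * v x‖ ≤ C * (|S| * ‖F x‖) + C * ‖v x‖ := by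
      refine norm_add_le_of_le ?_ ?_
      · rw [norm_mul, usF x, norm_mul]
        exact mul_le_mul (hpC x) (mul_le_mul_of_nonneg_right hSx (norm_nonneg _))
          (by positivity) hC
      · rw [norm_mul]
        exact mul_le_mul_of_nonneg_right (hqC x) (norm_nonneg _)
    have b4 : ‖r x * h1 x‖ ≤ (c : ℝ)⁻¹ * (K * (∑ i, ‖W i x‖)
        + (C * (|S| * ‖F x‖) + C * ‖v x‖)) := by
      rw [norm_mul]
      exact mul_le_mul (br x) (norm_sub_le_of_le b1 b3) (norm_nonneg _) (by positivity)
    refine (norm_sub_le_of_le b4 b2).trans ?_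
    have n1 : 0 ≤ ∑ i, ‖W i x‖ := Finset.sum_nonneg fun i _ => norm_nonneg _
    have n2 := norm_nonneg (F x)
    have n3 := norm_nonneg (v x)
    have ci : (0 : ℝ) ≤ (c : ℝ)⁻¹ := by positivity
    have k1 : (0 : ℝ) ≤ K := K.2
    have k2 : (0 : ℝ) ≤ K' := K'.2
    have s1 := abs_nonneg S
    have t1 : (c : ℝ)⁻¹ * K + |S| * K' ≤ D := by
      rw [hDdef, mul_add, mul_add]
      have := mul_nonneg ci (mul_nonneg hC s1)
      have := mul_nonneg ci hC
      linarith
    have t2 : (c : ℝ)⁻¹ * (C * |S|) ≤ D := by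
      rw [hDdef, mul_add, mul_add]
      have := mul_nonneg ci k1
      have := mul_nonneg ci hC
      have := mul_nonneg s1 k2
      linarith
    have t3 : (c : ℝ)⁻¹ * C ≤ D := by
      rw [hDdef, mul_add, mul_add]
      have := mul_nonneg ci k1
      have := mul_nonneg ci (mul_nonneg hC s1)
      have := mul_nonneg s1 k2
      linarith
    have := mul_le_mul_of_nonneg_right t1 n1
    have := mul_le_mul_of_nonneg_right t2 n2
    have := mul_le_mul_of_nonneg_right t3 n3
    linarith
  have mh : MemLp h2 2 := by
    have mg : MemLp (fun x => (∑ i, ‖W i x‖) + ‖F x‖ + ‖v x‖) 2 :=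
      ((memLp_finsetSum _ fun i _ => (mW i).norm).add mF.norm).add hv.norm
    refine mg.of_le_mul (c := D) ?_ ?_
    · refine (lr.continuous.aestronglyMeasurable.mul lh1.aestronglyMeasurable).sub ?_
      exact Finset.aestronglyMeasurable_fun_sum _ fun i _ =>
        (l1 i).aestronglyMeasurable.mul (measurable_partialDeriv r i).aestronglyMeasurable
    · filter_upwards [h20] with x hx
      by_cases hxB : x ∈ B
      · exact (bound x hxB).trans (mul_le_mul_of_nonneg_left (le_abs_self _) hD0)
      · rw [hx (memB.1 hxB), norm_zero]
        positivity
  -- The 5 is Cauchy–Schwarz for five summands: three gradient components, `F` and `v`.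
  refine ⟨B.indicator F, B.indicator h2, fun i => B.indicator (W i), 5 * D ^ 2,
    ⟨fun x hx => indicator_of_notMem (memB.2 hx) _, fun i x hx => indicator_of_notMem (memB.2 hx) _,
      fun x hx => indicator_of_notMem (memB.2 hx) _, mF.indicator mB, fun i => (mW i).indicator mB,
      mh.indicator mB, fun i => (dF i).congr_ae (ind F0) (ind (W0' i)), fun φ hφ => ?_⟩,
    ?_, by positivity, .of_forall fun x => ?_⟩
  · refine Eq.trans (integral_congr_ae ?_) ((div2 φ hφ).trans (integral_congr_ae ?_))
    · filter_upwards [ae_all_iff.2 fun i => ind (W0' i)] with x hx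
      exact Finset.sum_congr rfl fun i _ => by rw [← hx i]
    · filter_upwards [ind h20] with x hx
      rw [← hx]
  · filter_upwards [ind F0] with x hx
    rw [← hx, usF x]
  · by_cases hxB : x ∈ B
    · simp only [indicator_of_mem hxB]
      refine (pow_le_pow_left₀ (norm_nonneg _) (bound x hxB) 2).trans ?_
      rw [mul_pow, mul_comm 5, mul_assoc]
      refine mul_le_mul_of_nonneg_left ?_ (sq_nonneg D)
      simp only [Fin.sum_univ_three]
      nlinarith [sq_nonneg (‖W 0 x‖ - ‖W 1 x‖), sq_nonneg (‖W 0 x‖ - ‖W 2 x‖),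
        sq_nonneg (‖W 1 x‖ - ‖W 2 x‖), sq_nonneg (‖W 0 x‖ - ‖F x‖), sq_nonneg (‖W 1 x‖ - ‖F x‖),
        sq_nonneg (‖W 2 x‖ - ‖F x‖), sq_nonneg (‖W 0 x‖ - ‖v x‖), sq_nonneg (‖W 1 x‖ - ‖v x‖),
        sq_nonneg (‖W 2 x‖ - ‖v x‖), sq_nonneg (‖F x‖ - ‖v x‖)]
    · rw [indicator_of_notMem hxB, norm_zero, zero_pow two_ne_zero]
      positivity

end WeakSolutions

/-! ### Principal square roots and uniform positivity of the parameters. -/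

noncomputable section PrincipalRoots

open Filter Topology

/-- The principal root ζ has argument in [-π/2, π/2], hence Re ζ ≥ 0, and ζ² = z gives (Re ζ)² = Re
z + (Im ζ)² ≥ c. -/
lemma sqrt_le_re_cpow_half {z : ℂ} {c : ℝ} (hc : 0 < c) (hz : c ≤ z.re) :
    √c ≤ (z ^ (1 / 2 : ℂ)).re := by
  have hz0 : z ≠ 0 := fun h => by rw [h, Complex.zero_re] at hz; linarith
  have hsq : (z ^ (1 / 2 : ℂ)) * (z ^ (1 / 2 : ℂ)) = z := by
    rw [← Complex.cpow_add _ _ hz0]; norm_num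
  have hre : 0 ≤ (z ^ (1 / 2 : ℂ)).re := by
    rw [Complex.cpow_def_of_ne_zero hz0, Complex.exp_re]
    refine mul_nonneg (Real.exp_pos _).le (Real.cos_nonneg_of_mem_Icc ?_)
    have h1 := Complex.neg_pi_lt_arg z
    have h2 := Complex.arg_le_pi z
    have h3 : (Complex.log z * (1 / 2)).im = z.arg / 2 := by
      rw [show (1 / 2 : ℂ) = ((1 / 2 : ℝ) : ℂ) by push_cast; rfl, Complex.im_mul_ofReal,
        Complex.log_im]
      ring
    rw [h3]
    constructor <;> linarith
  refine Real.sqrt_le_iff.2 ⟨hre, hz.trans ?_⟩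
  have := congrArg Complex.re hsq
  rw [Complex.mul_re] at this
  nlinarith [sq_nonneg (z ^ (1 / 2 : ℂ)).im]

/-- Lipschitz complex-valued functions with real part bounded below by a positive constant. -/
structure IsLipschitzPositive (ρ : R3 → ℂ) : Prop where
  lipschitz : ∃ K, LipschitzWith K ρ
  re_ge : ∃ c : ℝ, 0 < c ∧ ∀ x, c ≤ (ρ x).re

/-- The Lipschitz bound follows from |√a - √b|·|√a + √b| = |a - b|, the sum being bounded below by
its real part. -/
lemma IsLipschitzPositive.sqrtFun {ρ : R3 → ℂ} (h : IsLipschitzPositive ρ) :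
    IsLipschitzPositive (sqrtFun ρ) := by
  obtain ⟨K, hK⟩ := h.lipschitz
  obtain ⟨c, hc, hcρ⟩ := h.re_ge
  have hre : ∀ x, √c ≤ (_root_.sqrtFun ρ x).re := fun x => sqrt_le_re_cpow_half hc (hcρ x)
  have hsc : 0 < √c := Real.sqrt_pos.2 hc
  refine ⟨⟨K / (Real.toNNReal √c), LipschitzWith.of_dist_le_mul fun x y => ?_⟩, √c, hsc, hre⟩
  have hsq : ∀ x, _root_.sqrtFun ρ x * _root_.sqrtFun ρ x = ρ x := fun x => by
    have hz0 : ρ x ≠ 0 := fun h => by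
      have := hcρ x
      rw [h, Complex.zero_re] at this
      linarith
    rw [_root_.sqrtFun, ← Complex.cpow_add _ _ hz0]
    norm_num
  have h1 : ‖_root_.sqrtFun ρ x - _root_.sqrtFun ρ y‖ * ‖_root_.sqrtFun ρ x + _root_.sqrtFun ρ y‖
      = ‖ρ x - ρ y‖ := by
    rw [← norm_mul, ← hsq x, ← hsq y]
    ring_nf
  have h2 : √c ≤ ‖_root_.sqrtFun ρ x + _root_.sqrtFun ρ y‖ := by
    refine le_trans ?_ (Complex.re_le_norm _)
    rw [Complex.add_re]
    linarith [hre x, hre y]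
  have h3 := hK.dist_le_mul x y
  rw [dist_eq_norm, ← h1] at h3
  rw [dist_eq_norm]
  push_cast
  rw [Real.coe_toNNReal _ hsc.le, div_mul_eq_mul_div, le_div_iff₀ hsc]
  exact (mul_le_mul_of_nonneg_left h2 (norm_nonneg _)).trans h3

lemma IsLipschitzPositive.add {ρ τ : R3 → ℂ} (h : IsLipschitzPositive ρ)
    (h' : IsLipschitzPositive τ) : IsLipschitzPositive (fun x => ρ x + τ x) := by
  obtain ⟨K, hK⟩ := h.lipschitz
  obtain ⟨c, hc, hcρ⟩ := h.re_ge
  obtain ⟨K', hK'⟩ := h'.lipschitz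
  obtain ⟨c', hc', hcρ'⟩ := h'.re_ge
  refine ⟨⟨K + K', hK.add hK'⟩, c + c', by positivity, fun x => ?_⟩
  rw [Complex.add_re]
  exact add_le_add (hcρ x) (hcρ' x)

lemma IsLipschitzPositive.sqrtSum {ρ₁ ρ₂ : R3 → ℂ} (h₁ : IsLipschitzPositive ρ₁)
    (h₂ : IsLipschitzPositive ρ₂) : IsLipschitzPositive (sqrtSum ρ₁ ρ₂) :=
  h₁.sqrtFun.add h₂.sqrtFun

lemma IsLipschitzPositive.continuous {ρ : R3 → ℂ} (h : IsLipschitzPositive ρ) : Continuous ρ :=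
  h.lipschitz.choose_spec.continuous

lemma IsLipschitzPositive.exists_le_norm {ρ : R3 → ℂ} (h : IsLipschitzPositive ρ) :
    ∃ c : NNReal, 0 < c ∧ ∀ x, c ≤ ‖ρ x‖ := by
  obtain ⟨c, hc, hcρ⟩ := h.re_ge
  exact ⟨⟨c, hc.le⟩, hc, fun x => (hcρ x).trans (Complex.re_le_norm _)⟩

lemma IsLipschitzPositive.ne_zero {ρ : R3 → ℂ} (h : IsLipschitzPositive ρ) (x : R3) :
    ρ x ≠ 0 := by
  obtain ⟨c, hc, hcρ⟩ := h.exists_le_norm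
  exact norm_pos_iff.1 ((NNReal.coe_pos.2 hc).trans_le (hcρ x))

/-- Compactness handles the ball. Outside it the background constant is a value of `a`, hence
positive. -/
lemma exists_pos_le_of_eq_background {a : R3 → ℝ} {a₀ R : ℝ} (ha : Continuous a)
    (hpos : ∀ x, 0 < a x) (hR : ∀ x, R ≤ ‖x‖ → a x = a₀) : ∃ c, 0 < c ∧ ∀ x, c ≤ a x := by
  obtain ⟨x₀, -, hx₀⟩ := (isCompact_closedBall (0 : R3) |R|).exists_isMinOn
    ⟨0, by simp⟩ ha.continuousOn
  have hne : ∃ y : R3, R ≤ ‖y‖ := by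
    refine ⟨EuclideanSpace.single 0 R, ?_⟩
    simpa using le_abs_self R
  obtain ⟨y, hy⟩ := hne
  refine ⟨min (a x₀) (a y), lt_min (hpos _) (hpos _), fun x => ?_⟩
  by_cases hx : R ≤ ‖x‖
  · rw [hR x hx, ← hR y hy]
    exact min_le_right _ _
  · refine (min_le_left _ _).trans (hx₀ ?_)
    simpa using (not_le.1 hx).le.trans (le_abs_self R)

lemma IsAdmissible.isLipschitzPositive_permeability {Ω : Set R3} {μ₀ ε₀ : ℝ} {μ ε σ : R3 → ℝ}
    (h : IsAdmissible Ω μ₀ ε₀ μ ε σ) : IsLipschitzPositive (fun x => (μ x : ℂ)) := by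
  obtain ⟨K, hK⟩ := h.lipschitz_μ
  obtain ⟨R, hR⟩ := h.eq_background
  refine ⟨⟨K, LipschitzWith.of_dist_le_mul fun x y => ?_⟩, ?_⟩
  · rw [Complex.dist_of_im_eq (by simp)]
    simpa using hK.dist_le_mul x y
  · simpa using exists_pos_le_of_eq_background hK.continuous h.pos_μ fun x hx => (hR x hx).1

lemma IsAdmissible.isLipschitzPositive_permittivity {Ω : Set R3} {μ₀ ε₀ : ℝ} {μ ε σ : R3 → ℝ}
    (h : IsAdmissible Ω μ₀ ε₀ μ ε σ) (ω : ℝ) :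
    IsLipschitzPositive (complexPermittivity ω ε σ) := by
  obtain ⟨K, hK⟩ := h.lipschitz_ε
  obtain ⟨K', hK'⟩ := h.lipschitz_σ
  obtain ⟨R, hR⟩ := h.eq_background
  refine ⟨⟨K + K' * ‖ω⁻¹‖₊, LipschitzWith.of_dist_le_mul fun x y => ?_⟩, ?_⟩
  · have e : complexPermittivity ω ε σ x - complexPermittivity ω ε σ y
        = ((ε x - ε y : ℝ) : ℂ) + Complex.I * (((σ x - σ y) * ω⁻¹ : ℝ) : ℂ) := by
      simp only [complexPermittivity]
      push_cast
      ring
    rw [dist_eq_norm, e]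
    refine (norm_add_le _ _).trans ?_
    rw [norm_mul, Complex.norm_I, one_mul, Complex.norm_real, Complex.norm_real, norm_mul]
    have h1 := hK.dist_le_mul x y
    have h2 := mul_le_mul_of_nonneg_right (hK'.dist_le_mul x y) (norm_nonneg ω⁻¹)
    rw [dist_eq_norm] at h1 h2
    push_cast
    simp only [dist_eq_norm] at *
    linarith
  · have e : ∀ x, (complexPermittivity ω ε σ x).re = ε x := fun x => by
      rw [complexPermittivity, mul_div_assoc, ← Complex.ofReal_div]
      simp
    simp only [e]
    exact exists_pos_le_of_eq_background hK.continuous h.pos_ε fun x hx => (hR x hx).2.1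

/-! ### Coefficients of the system and the conclusion. -/

lemma indicator_measurable_and_bounded {Ω : Set R3} (ho : IsOpen Ω) (hb : Bornology.IsBounded Ω)
    {k : R3 → ℂ} (hk : Continuous k) :
    AEStronglyMeasurable (Ω.indicator k) ∧ ∃ C, ∀ x, ‖Ω.indicator k x‖ ≤ C := by
  refine ⟨hk.aestronglyMeasurable.indicator ho.measurableSet, ?_⟩
  obtain ⟨C, hC⟩ := hb.isCompact_closure.exists_bound_of_continuousOn hk.continuousOn
  refine ⟨|C|, fun x => ?_⟩
  by_cases hx : x ∈ Ω
  · rw [indicator_of_mem hx]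
    exact (hC x (subset_closure hx)).trans (le_abs_self C)
  · rw [indicator_of_notMem hx, norm_zero]
    exact abs_nonneg C

/-- The two equations are exchanged by swapping γ with μ and f with g, so this single form serves
both. -/
lemma IsWeakSolution.exists_isLaplacianPair_of_coeff {Ω : Set R3} (ho : IsOpen Ω)
    (hb : Bornology.IsBounded Ω) {ω : ℝ} {ρ₁ ρ₂ τ₁ τ₂ : R3 → ℂ} (hρ₁ : IsLipschitzPositive ρ₁)
    (hρ₂ : IsLipschitzPositive ρ₂) (hτ₁ : IsLipschitzPositive τ₁) (hτ₂ : IsLipschitzPositive τ₂)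
    {u v : Lp ℂ 2 (volume : Measure R3)} (hu : MemH1 u) {R : ℝ}
    (hu0 : ∀ᵐ x, R < ‖x‖ → u x = 0) (hv0 : ∀ᵐ x, R < ‖x‖ → v x = 0)
    (hsol : IsWeakSolution (sqrtSum ρ₁ ρ₂) (diagCoeff Ω ω ρ₁ ρ₂ τ₁ τ₂)
      (offDiagCoeff Ω ω ρ₁ ρ₂ τ₁ τ₂) u v) :
    ∃ F h W M, IsLaplacianPair R F h W ∧ (∀ᵐ x, u x = sqrtSum ρ₁ ρ₂ x * F x) ∧ 0 ≤ M ∧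
      ∀ᵐ x, ‖h x‖ ^ 2 ≤ M * ((∑ i, ‖W i x‖ ^ 2) + ‖F x‖ ^ 2 + ‖v x‖ ^ 2) := by
  have hs := hρ₁.sqrtSum hρ₂
  obtain ⟨K, hK⟩ := hs.lipschitz
  obtain ⟨c, hc, hcs⟩ := hs.exists_le_norm
  have c1 := hρ₁.sqrtFun.continuous
  have c2 := hρ₂.sqrtFun.continuous
  have c3 := hρ₁.continuous
  have c4 := hρ₂.continuous
  have c5 := hτ₁.continuous
  have c6 := hτ₂.continuous
  have c7 : Continuous (fun x => sqrtSum τ₁ τ₂ x / sqrtSum ρ₁ ρ₂ x) :=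
    (hτ₁.sqrtSum hτ₂).continuous.div hs.continuous hs.ne_zero
  obtain ⟨mp, P, hP⟩ := indicator_measurable_and_bounded ho hb (k := fun x =>
    (ω : ℂ) ^ 2 * sqrtFun ρ₁ x * sqrtFun ρ₂ x * (τ₁ x + τ₂ x)) (by fun_prop)
  obtain ⟨mq, Q, hQ⟩ := indicator_measurable_and_bounded ho hb (k := fun x =>
    (ω : ℂ) ^ 2 * sqrtFun ρ₁ x * sqrtFun ρ₂ x * (ρ₁ x + ρ₂ x)
    * (sqrtSum τ₁ τ₂ x / sqrtSum ρ₁ ρ₂ x)) (by fun_prop)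
  exact hsol.exists_isLaplacianPair hK hc hcs (C := max P Q) mp mq
    (fun x => (hP x).trans (le_max_left _ _)) (fun x => (hQ x).trans (le_max_right _ _))
    (Lp.memLp u) (Lp.memLp v) hu0 hv0 hu.exists_hasWeakDeriv

/-- Trades the other unknown for its quotient, `s` being bounded on the ball that carries `F`. Every
larger constant is allowed so that both inequalities can share one. -/
lemma ae_bound_of_eq_mul {R : ℝ} {s F h k v : R3 → ℂ} {W V : Fin 3 → R3 → ℂ}
    (hs : Continuous s) (H : IsLaplacianPair R F k V) (hv : ∀ᵐ x, v x = s x * F x)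
    {G : R3 → ℂ} {M : ℝ} (hM : 0 ≤ M)
    (hb : ∀ᵐ x, ‖h x‖ ^ 2 ≤ M * ((∑ i, ‖W i x‖ ^ 2) + ‖G x‖ ^ 2 + ‖v x‖ ^ 2)) :
    ∃ M', 0 ≤ M' ∧ ∀ M'', M' ≤ M'' →
      ∀ᵐ x, ‖h x‖ ^ 2 ≤ M'' * ((∑ i, ‖W i x‖ ^ 2) + ‖G x‖ ^ 2 + ‖F x‖ ^ 2) := by
  obtain ⟨S, hS⟩ := (isCompact_closedBall (0 : R3) R).exists_bound_of_continuousOn hs.continuousOn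
  refine ⟨M * (1 + S ^ 2), by positivity, fun M'' hM'' => ?_⟩
  filter_upwards [hb, hv] with x hx hvx
  have n1 : 0 ≤ ∑ i, ‖W i x‖ ^ 2 := Finset.sum_nonneg fun i _ => sq_nonneg _
  have h1 : ‖v x‖ ^ 2 ≤ S ^ 2 * ‖F x‖ ^ 2 := by
    rw [hvx]
    by_cases hxR : R < ‖x‖
    · simp [H.zero_u x hxR]
    · rw [norm_mul, mul_pow]
      gcongr
      exact hS x (by simpa using hxR)
  refine (hx.trans ?_).trans (mul_le_mul_of_nonneg_right hM'' (by positivity))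
  rw [mul_assoc]
  refine mul_le_mul_of_nonneg_left ?_ hM
  nlinarith [mul_nonneg (sq_nonneg S) n1, mul_nonneg (sq_nonneg S) (sq_nonneg ‖G x‖),
    sq_nonneg ‖F x‖]

/-- Allowing every larger radius lets `f` and `g` share a single ball. -/
lemma IsCompactlySupported.exists_radius {f : Lp ℂ 2 (volume : Measure R3)}
    (hf : IsCompactlySupported f) : ∃ R₀, ∀ R, R₀ ≤ R → ∀ᵐ x, R < ‖x‖ → f x = 0 := by
  obtain ⟨K, hK, h⟩ := hf
  obtain ⟨R₀, hR₀⟩ := hK.isBounded.subset_closedBall 0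
  refine ⟨R₀, fun R hR => ?_⟩
  filter_upwards [h] with x hx hxR
  refine hx fun hxK => ?_
  have : ‖x‖ ≤ R₀ := by simpa using hR₀ hxK
  linarith

end PrincipalRoots

theorem mainTheorem7
    (Ω : Set R3) (hΩ_open : IsOpen Ω) (hΩ_bounded : Bornology.IsBounded Ω)
    (ω : ℝ) (hω : 0 < ω) (μ₀ ε₀ : ℝ) (hμ₀ : 0 < μ₀) (hε₀ : 0 < ε₀)
    (μ₁ ε₁ σ₁ μ₂ ε₂ σ₂ : R3 → ℝ)
    (h₁ : IsAdmissible Ω μ₀ ε₀ μ₁ ε₁ σ₁) (h₂ : IsAdmissible Ω μ₀ ε₀ μ₂ ε₂ σ₂)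
    (h_outside : ∀ x, x ∉ Ω → μ₁ x = μ₂ x ∧ ε₁ x = ε₂ x ∧ σ₁ x = σ₂ x)
    (m₁ m₂ γ₁ γ₂ : R3 → ℂ)
    (hm₁ : m₁ = fun x => (μ₁ x : ℂ)) (hm₂ : m₂ = fun x => (μ₂ x : ℂ))
    (hγ₁ : γ₁ = complexPermittivity ω ε₁ σ₁) (hγ₂ : γ₂ = complexPermittivity ω ε₂ σ₂)
    (f g : Lp ℂ 2 (volume : Measure R3))
    (hf : MemH1 f) (hg : MemH1 g)
    (hf_supp : IsCompactlySupported f) (hg_supp : IsCompactlySupported g)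
    (h_eq_f : IsWeakSolution (sqrtSum γ₁ γ₂)
      (diagCoeff Ω ω γ₁ γ₂ m₁ m₂) (offDiagCoeff Ω ω γ₁ γ₂ m₁ m₂) f g)
    (h_eq_g : IsWeakSolution (sqrtSum m₁ m₂)
      (diagCoeff Ω ω m₁ m₂ γ₁ γ₂) (offDiagCoeff Ω ω m₁ m₂ γ₁ γ₂) g f) :
    f = 0 ∧ g = 0 := by
  obtain ⟨R₁, hR₁⟩ := hf_supp.exists_radius
  obtain ⟨R₂, hR₂⟩ := hg_supp.exists_radius
  have f0 := hR₁ (max R₁ R₂) (le_max_left _ _)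
  have g0 := hR₂ (max R₁ R₂) (le_max_right _ _)
  have pm₁ : IsLipschitzPositive m₁ := hm₁ ▸ h₁.isLipschitzPositive_permeability
  have pm₂ : IsLipschitzPositive m₂ := hm₂ ▸ h₂.isLipschitzPositive_permeability
  have pγ₁ : IsLipschitzPositive γ₁ := hγ₁ ▸ h₁.isLipschitzPositive_permittivity ω
  have pγ₂ : IsLipschitzPositive γ₂ := hγ₂ ▸ h₂.isLipschitzPositive_permittivity ω
  obtain ⟨F, h, U, M, HF, hfF, hM, hb⟩ := h_eq_f.exists_isLaplacianPair_of_coeff hΩ_open hΩ_bounded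
    pγ₁ pγ₂ pm₁ pm₂ hf f0 g0
  obtain ⟨G, k, V, N, HG, hgG, hN, kb⟩ := h_eq_g.exists_isLaplacianPair_of_coeff hΩ_open hΩ_bounded
    pm₁ pm₂ pγ₁ pγ₂ hg g0 f0
  obtain ⟨M', hM', hb'⟩ := ae_bound_of_eq_mul (pm₁.sqrtSum pm₂).continuous HG hgG hM hb
  obtain ⟨N', hN', kb'⟩ := ae_bound_of_eq_mul (pγ₁.sqrtSum pγ₂).continuous HF hfF hN kb
  obtain ⟨hF, hG⟩ := HF.eq_zero_of_coupled_inequality HG (hM'.trans (le_max_left M' N'))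
    (hb' _ (le_max_left _ _)) (kb' _ (le_max_right _ _))
  refine ⟨(Lp.eq_zero_iff_ae_eq_zero).2 ?_, (Lp.eq_zero_iff_ae_eq_zero).2 ?_⟩
  · filter_upwards [hfF, hF] with x h1 h2
    simp [h1, h2]
  · filter_upwards [hgG, hG] with x h1 h2
    simp [h1, h2]
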